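/- Let $N\ge 1$, $R>0$, and let $B_R\subset\mathbb R^N$ be the open ball of radius $R$ centred at the origin. Put $$c_N=\pi^{-N/2}\,\Gamma(N/2),\qquad \rho_N=2\log 2+\frac{\Gamma'(N/2)}{\Gamma(N/2)}-\gamma ,$$ where $\gamma$ is the Euler--Mascheroni constant, and let $k(z)=c_N|z|^{-N}\chi_{B_1}(z)$ and $j(z)=c_N|z|^{-N}\chi_{\mathbb R^N\setminus B_1}(z)$. For $u,v:\mathbb R^N\to\mathbb R$ set $$\mathcal E(u,v)=\frac12\iint_{\mathbb R^N\times\mathbb R^N}(u(x)-u(y))(v(x)-v(y))\,k(x-y)\,dx\,dy .$$ Let $\mathbb H(\mathbb R^N)$ be the space of all $u\in L^2(\mathbb R^N)$ with $\mathcal E(u,u)<\infty$, and for an open set $\Omega\subset\mathbb R^N$ let $\mathbb H(\Omega)$ be the space of all $u\in\mathbb H(\mathbb R^N)$ with $u=0$ a.e. in $\mathbb R^N\setminus\Omega$. The bilinear form associated with the logarithmic Laplacian $L_\Delta$ (the operator with Fourier symbol $2\log|\xi|$) is $$\mathcal E_L(u,v)=\mathcal E(u,v)-\iint_{\mathbb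 R^N\times\mathbb R^N}u(x)\,v(y)\,j(x-y)\,dx\,dy+\rho_N\int_{\mathbb R^N}uv\,dx .$$ For a bounded open set $\Omega$ with Lipschitz boundary and $g\in L^2(\Omega)$, a function $u\in\mathbb H(\mathbb R^N)$ is a weak solution of $L_\Delta u=g$ in $\Omega$ if, for every nonnegative $\varphi\in\mathbb H(\Omega)$, both $\mathcal E_L(u,\varphi)\ge\int_\Omega g\varphi\,dx$ and $\mathcal E_L(u,\varphi)\le\int_\Omega g\varphi\,dx$ hold. **Corollary.** Let $f:\mathbb R\to\mathbb R$ be locally Lipschitz and let $u\in C(\overline{B_R})\cap\mathbb H(B_R)$ be a weak solution of $$L_\Delta u=f(u)\ \text{ in } B_R,\qquad u=0\ \text{ in }\mathbb R^N\setminus B_R,$$ with $u>0$ in $B_R$. Then $u$ is radial and radially strictly decreasing: there is a function $g:\mathbb R\to\mathbb R$ such that $u(x)=g(|x|)$ for all $x\in\mathbb R^N$, and $g$ is strictly decreasing on $[0,R]$. -/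

import Mathlib

open MeasureTheory

namespace LogLap

/-- The Euclidean space `ℝ^N`. -/
abbrev Space (N : ℕ) : Type := EuclideanSpace ℝ (Fin N)

/-- The constant `c_N = π^(-N/2) Γ(N/2)`. -/
noncomputable def cConst (N : ℕ) : ℝ :=
  Real.Gamma ((N : ℝ) / 2) / Real.pi ^ ((N : ℝ) / 2)

/-- The constant `ρ_N = 2 log 2 + ψ(N/2) - γ`, where `ψ = Γ'/Γ` is the digamma function and `γ`
is the Euler-Mascheroni constant. With `c_N` and `ρ_N`, the operator `L_Δ` has
Fourier symbol `2 log |ξ|`. -/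
noncomputable def rhoConst (N : ℕ) : ℝ :=
  2 * Real.log 2 + logDeriv Real.Gamma ((N : ℝ) / 2) - Real.eulerMascheroniConstant

/-- The kernel `k(z) = c_N |z|^(-N)` inside the unit ball, `0` outside. -/
noncomputable def kernelK (N : ℕ) : Space N → ℝ :=
  (Metric.ball (0 : Space N) 1).indicator fun z => cConst N / ‖z‖ ^ N

/-- The kernel `j(z) = c_N |z|^(-N)` outside the unit ball, `0` inside. -/
noncomputable def kernelJ (N : ℕ) : Space N → ℝ :=
  (Metric.ball (0 : Space N) 1)ᶜ.indicator fun z => cConst N / ‖z‖ ^ N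

/-- The form `𝓔(u,v) = 1/2 ∬ (u(x) - u(y)) (v(x) - v(y)) k(x - y) dx dy`. -/
noncomputable def energy {N : ℕ} (u v : Space N → ℝ) : ℝ :=
  (1 / 2) * ∫ p : Space N × Space N,
    (u p.1 - u p.2) * (v p.1 - v p.2) * kernelK N (p.1 - p.2)

/-- Membership in `ℍ(ℝ^N)`: `u ∈ L²(ℝ^N)` and `𝓔(u,u) < ∞`. The integrand of `𝓔(u,u)` is
nonnegative and measurable, so that finiteness of the integral is integrability. -/
def MemH {N : ℕ} (u : Space N → ℝ) : Prop :=
  MemLp u 2 volume ∧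
    Integrable (fun p : Space N × Space N =>
      (u p.1 - u p.2) * (u p.1 - u p.2) * kernelK N (p.1 - p.2)) volume

/-- Membership in `ℍ(Ω)`: `u ∈ ℍ(ℝ^N)` and `u = 0` a.e. in the complement of `Ω`. -/
def MemHOn {N : ℕ} (Ω : Set (Space N)) (u : Space N → ℝ) : Prop :=
  MemH u ∧ ∀ᵐ x, x ∉ Ω → u x = 0

/-- The bilinear form of the logarithmic Laplacian,
`𝓔_L(u,v) = 𝓔(u,v) - ∬ u(x) v(y) j(x - y) dx dy + ρ_N ∫ u v dx`. -/
noncomputable def formL {N : ℕ} (u v : Space N → ℝ) : ℝ :=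
  energy u v
    - (∫ p : Space N × Space N, u p.1 * v p.2 * kernelJ N (p.1 - p.2))
    + rhoConst N * ∫ x, u x * v x

/-- `u` is a weak supersolution of `L_Δ u = g` in `Ω`, where `g ∈ L²(Ω)`. -/
def IsWeakSupersolution {N : ℕ} (Ω : Set (Space N)) (g u : Space N → ℝ) : Prop :=
  MemLp g 2 (volume.restrict Ω) ∧ MemH u ∧
    ∀ φ : Space N → ℝ, MemHOn Ω φ → (∀ᵐ x, 0 ≤ φ x) →
      ∫ x in Ω, g x * φ x ≤ formL u φ

/-- `u` is a weak subsolution of `L_Δ u = g` in `Ω`, where `g ∈ L²(Ω)`. -/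
def IsWeakSubsolution {N : ℕ} (Ω : Set (Space N)) (g u : Space N → ℝ) : Prop :=
  MemLp g 2 (volume.restrict Ω) ∧ MemH u ∧
    ∀ φ : Space N → ℝ, MemHOn Ω φ → (∀ᵐ x, 0 ≤ φ x) →
      formL u φ ≤ ∫ x in Ω, g x * φ x

/-- `u` is a weak solution of `L_Δ u = g` in `Ω`. -/
def IsWeakSolution {N : ℕ} (Ω : Set (Space N)) (g u : Space N → ℝ) : Prop :=
  IsWeakSupersolution Ω g u ∧ IsWeakSubsolution Ω g u

end LogLap

/-!
The proof is the method of moving planes, run entirely on the weak formulation.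

For a unit vector `e` and a number `l`, let `σ` be the reflection in the hyperplane `⟨e, x⟩ = l`,
let `H` be the half-space `⟨e, x⟩ > l`, and put `w = u ∘ σ - u`. The claim is that `w ≥ 0` in `H`
for every `l > 0`, with strict inequality inside the ball when `l < R`
(`le_refl_of_pos`, `lt_refl_of_le_refl`). The limit `l → 0` in all directions gives invariance
under every reflection through the origin, hence radial symmetry (`eq_of_norm_eq`), and the strict
inequality gives strict monotonicity along rays (`strictAntiOn_smul`).

To avoid singular integrals, the kernel `c |z|^(-N)` is replaced by
`G_ε(z) = c max(|z|, ε)^(-N)`, whose mass in the unit ball is `K_ε`. On functions of finite energy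
the form is the limit as `ε → 0` of
`(K_ε + ρ) ∫ u φ - ∬ u(x) φ(y) G_ε(x - y)` (`tendsto_regForm`), where all integrals converge
absolutely. Three properties of `G_ε` are used. It is radially nonincreasing, so that for
antisymmetric functions its difference under `σ` is a nonnegative kernel in `H`
(`integral_le_integral_antisymm`). Away from the diagonal it is independent of small `ε`, and the
difference is there strictly positive (`exists_regKernel_sub_ge`). Its mass `K_ε` diverges, whereas
a set of small measure carries much less than `K_ε` (`exists_setIntegral_regKernel_le`), so the
form is coercive with a large constant on functions supported in such sets.

Both maximum principles come from one computation (`exists_deficit_ae_eq_zero`): test the equation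
of `w` with `φ = (a - w)⁺` in `H`, for a barrier `a ≥ 0`. This is an admissible test function
(`MemH.fold`). If the support of `φ` is small and the operator applied to `max w a`, extended
antisymmetrically, is negative enough on it, coercivity beats the Lipschitz constant of the
nonlinearity and `φ = 0`. With `a = 0` this is the maximum principle in sets of small measure
(`exists_small_maximum_principle`). With `a` a flat cone over a small ball it is the strong maximum
principle (`strong_maximum_principle`): if `w > 0` somewhere in `H`, the nonlocal term pushes `w`
up by a fixed amount near every point, which pays for a flat enough cone.

The planes move because, if `w ≥ 0` at level `s`, the sets where `w < 0` at levels `l` slightly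
below `s` have measure tending to zero, by the strong maximum principle and dominated convergence
(`eventually_le_refl`). The same argument starts the procedure at `s = R`.
-/

open MeasureTheory Filter Topology

namespace LogLap

/-! ### The regularised kernel -/

/-- The kernel `c_N max(|z|, ε)^(-N)`: the kernel `c_N |z|^(-N)` of the logarithmic Laplacian
flattened inside the ball of radius `ε`. For `ε > 0` it is bounded, continuous and radially
nonincreasing, also at the origin. -/
noncomputable def regKernel (N : ℕ) (ε : ℝ) (z : Space N) : ℝ :=
  cConst N / (max ‖z‖ ε) ^ N

/-- The mass of the regularised kernel in the unit ball. -/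
noncomputable def regMass (N : ℕ) (ε : ℝ) : ℝ :=
  ∫ z in Metric.ball (0 : Space N) 1, regKernel N ε z

variable {N : ℕ} {ε : ℝ}

lemma cConst_pos (hN : 1 ≤ N) : 0 < cConst N := by
  have : (0 : ℝ) < N := by exact_mod_cast hN
  exact div_pos (Real.Gamma_pos_of_pos (by positivity)) (Real.rpow_pos_of_pos Real.pi_pos _)

lemma nontrivial_space (hN : 1 ≤ N) : Nontrivial (Space N) := by
  have : Nonempty (Fin N) := ⟨⟨0, hN⟩⟩
  infer_instance

lemma regKernel_nonneg (hN : 1 ≤ N) (hε : 0 < ε) (z : Space N) : 0 ≤ regKernel N ε z :=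
  div_nonneg (cConst_pos hN).le (pow_nonneg (le_max_of_le_right hε.le) _)

lemma regKernel_le (hN : 1 ≤ N) (hε : 0 < ε) (z : Space N) :
    regKernel N ε z ≤ cConst N / ε ^ N :=
  div_le_div_of_nonneg_left (cConst_pos hN).le (pow_pos hε _)
    (pow_le_pow_left₀ hε.le (le_max_right _ _) _)

lemma continuous_regKernel (hε : 0 < ε) : Continuous (regKernel N ε) := by
  unfold regKernel
  refine Continuous.div continuous_const (by fun_prop) fun z => ?_
  exact (pow_pos (lt_max_of_lt_right hε) _).ne'

lemma regKernel_anti (hN : 1 ≤ N) (hε : 0 < ε) {z z' : Space N} (h : ‖z‖ ≤ ‖z'‖) :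
    regKernel N ε z' ≤ regKernel N ε z :=
  div_le_div_of_nonneg_left (cConst_pos hN).le (pow_pos (lt_max_of_lt_right hε) _)
    (pow_le_pow_left₀ (le_max_of_le_right hε.le) (max_le_max_right _ h) _)

lemma regKernel_congr {z z' : Space N} (h : ‖z‖ = ‖z'‖) : regKernel N ε z = regKernel N ε z' := by
  simp [regKernel, h]

lemma regKernel_anti_right (hN : 1 ≤ N) (hε : 0 < ε) {ε' : ℝ} (h : ε ≤ ε') (z : Space N) :
    regKernel N ε' z ≤ regKernel N ε z :=
  div_le_div_of_nonneg_left (cConst_pos hN).le (pow_pos (lt_max_of_lt_right hε) _)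
    (pow_le_pow_left₀ (le_max_of_le_right hε.le) (max_le_max_left _ h) _)

lemma regKernel_of_le {z : Space N} (h : ε ≤ ‖z‖) : regKernel N ε z = cConst N / ‖z‖ ^ N := by
  simp [regKernel, max_eq_left h]

lemma abs_regKernel_le (hN : 1 ≤ N) (hε : 0 < ε) (z : Space N) :
    ‖regKernel N ε z‖ ≤ cConst N / ε ^ N := by
  rw [Real.norm_of_nonneg (regKernel_nonneg hN hε z)]; exact regKernel_le hN hε z

lemma kernelJ_nonneg (hN : 1 ≤ N) (z : Space N) : 0 ≤ kernelJ N z :=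
  Set.indicator_nonneg (fun _ _ => div_nonneg (cConst_pos hN).le (by positivity)) _

lemma kernelK_nonneg (hN : 1 ≤ N) (z : Space N) : 0 ≤ kernelK N z :=
  Set.indicator_nonneg (fun _ _ => div_nonneg (cConst_pos hN).le (by positivity)) _

lemma kernelJ_le (hN : 1 ≤ N) (z : Space N) : kernelJ N z ≤ cConst N := by
  refine Set.indicator_le' (fun z hz => ?_) (fun _ _ => (cConst_pos hN).le) z
  have : 1 ≤ ‖z‖ := by simpa using hz
  exact div_le_self (cConst_pos hN).le (one_le_pow₀ this)

lemma measurable_kernelJ : Measurable (kernelJ N) :=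
  Measurable.indicator (by fun_prop) Metric.isOpen_ball.measurableSet.compl

lemma measurable_kernelK : Measurable (kernelK N) :=
  Measurable.indicator (by fun_prop) Metric.isOpen_ball.measurableSet

/-- The part of the regularised kernel inside the unit ball. -/
noncomputable def regK (N : ℕ) (ε : ℝ) : Space N → ℝ :=
  (Metric.ball (0 : Space N) 1).indicator (regKernel N ε)

lemma regKernel_eq_add (h1 : ε < 1) (z : Space N) :
    regKernel N ε z = regK N ε z + kernelJ N z := by
  by_cases hz : z ∈ Metric.ball (0 : Space N) 1
  · simp [regK, kernelJ, hz]
  · have : 1 ≤ ‖z‖ := by simpa using hz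
    simp only [regK, kernelJ, Set.indicator_of_notMem hz,
      Set.indicator_of_mem (Set.mem_compl hz), zero_add]
    exact regKernel_of_le (h1.le.trans this)

lemma regK_nonneg (hN : 1 ≤ N) (hε : 0 < ε) (z : Space N) : 0 ≤ regK N ε z :=
  Set.indicator_nonneg (fun _ _ => regKernel_nonneg hN hε _) _

lemma measurable_regK (hε : 0 < ε) : Measurable (regK N ε) :=
  (continuous_regKernel hε).measurable.indicator Metric.isOpen_ball.measurableSet

lemma abs_regK_le (hN : 1 ≤ N) (hε : 0 < ε) (z : Space N) :
    ‖regK N ε z‖ ≤ cConst N / ε ^ N :=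
  (norm_indicator_le_norm_self _ _).trans (abs_regKernel_le hN hε z)

lemma regK_neg (z : Space N) : regK N ε (-z) = regK N ε z := by
  simp [regK, Set.indicator, regKernel]

lemma integrable_regK (hN : 1 ≤ N) (hε : 0 < ε) : Integrable (regK N ε) := by
  refine IntegrableOn.integrable_indicator ?_ Metric.isOpen_ball.measurableSet
  refine Measure.integrableOn_of_bounded (M := cConst N / ε ^ N) measure_ball_lt_top.ne
    (continuous_regKernel hε).aestronglyMeasurable ?_
  exact Filter.Eventually.of_forall fun z => abs_regKernel_le hN hε z

lemma integral_regK : ∫ z, regK N ε z = regMass N ε :=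
  integral_indicator Metric.isOpen_ball.measurableSet

lemma regK_le_kernelK (hN : 1 ≤ N) {z : Space N} (hz : z ≠ 0) :
    regK N ε z ≤ kernelK N z := by
  refine Set.indicator_le_indicator ?_
  exact div_le_div_of_nonneg_left (cConst_pos hN).le (by positivity)
    (pow_le_pow_left₀ (norm_nonneg _) (le_max_left _ _) _)

lemma regK_eq_kernelK {z : Space N} (h : ε ≤ ‖z‖) : regK N ε z = kernelK N z := by
  by_cases hz : z ∈ Metric.ball (0 : Space N) 1
  · simp only [regK, kernelK, Set.indicator_of_mem hz, regKernel_of_le h]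
  · simp only [regK, kernelK, Set.indicator_of_notMem hz]

/-- The kernel is not integrable at the origin: its regularised mass is unbounded. This is the
coercivity of the form on functions supported in small sets. -/
lemma exists_le_regMass (hN : 1 ≤ N) (A : ℝ) :
    ∃ ε : ℝ, 0 < ε ∧ ε < 1 ∧ A ≤ regMass N ε := by
  have := nontrivial_space hN
  set b : ℝ := N * ((volume : Measure (Space N)).real (Metric.ball 0 1) * cConst N) with hb
  have hNpos : (0 : ℝ) < N := by exact_mod_cast hN
  have hbpos : 0 < b := by
    refine mul_pos hNpos (mul_pos ?_ (cConst_pos hN))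
    exact ENNReal.toReal_pos (Metric.measure_ball_pos volume _ one_pos).ne' measure_ball_lt_top.ne
  -- in polar coordinates the mass of the shell `ε < |z| < 1` is a multiple of `∫ dr / r`
  have key : ∀ ε : ℝ, 0 < ε → ε < 1 → b * (-Real.log ε) ≤ regMass N ε := by
    intro ε hε h1
    set g : ℝ → ℝ := (Set.Iio 1).indicator fun r => cConst N / (max r ε) ^ N with hg
    have hgz : ∀ z : Space N, regK N ε z = g ‖z‖ := by
      intro z
      simp [regK, hg, Set.indicator, regKernel]
    have hint : IntegrableOn (fun y : ℝ => y ^ (N - 1) • g y) (Set.Ioi 0) := by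
      have h := (integrable_fun_norm_addHaar (volume : Measure (Space N)) (f := g)).1
        ((integrable_regK hN hε).congr (Eventually.of_forall hgz))
      simpa using h
    have h2 : regMass N ε = N * ((volume : Measure (Space N)).real (Metric.ball 0 1) *
        ∫ y in Set.Ioi (0 : ℝ), y ^ (N - 1) * g y) := by
      rw [← integral_regK, integral_congr_ae (Eventually.of_forall hgz),
        integral_fun_norm_addHaar]
      simp
    have h3 : ∫ y in Set.Ioo ε 1, y ^ (N - 1) * g y
        ≤ ∫ y in Set.Ioi (0 : ℝ), y ^ (N - 1) * g y := by
      refine setIntegral_mono_set hint ?_ ?_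
      · filter_upwards [ae_restrict_mem measurableSet_Ioi] with y hy
        have hy : 0 < y := hy
        refine mul_nonneg (by positivity) (Set.indicator_nonneg (fun r _ => ?_) _)
        exact div_nonneg (cConst_pos hN).le (pow_nonneg (le_max_of_le_right hε.le) _)
      · exact Eventually.of_forall fun y hy => hε.trans hy.1
    have h4 : ∫ y in Set.Ioo ε 1, y ^ (N - 1) * g y = cConst N * (-Real.log ε) := by
      have : ∫ y in Set.Ioo ε 1, y ^ (N - 1) * g y = ∫ y in Set.Ioo ε 1, cConst N * y⁻¹ := by
        refine setIntegral_congr_fun measurableSet_Ioo fun y hy => ?_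
        have hy0 : 0 < y := hε.trans hy.1
        have : g y = cConst N / y ^ N := by
          simp only [hg]
          rw [Set.indicator_of_mem (show y ∈ Set.Iio 1 from hy.2), max_eq_left hy.1.le]
        simp only [this]
        obtain ⟨n, rfl⟩ : ∃ n, N = n + 1 := ⟨N - 1, by omega⟩
        simp only [Nat.add_sub_cancel, pow_succ]
        field_simp
      rw [this, integral_const_mul, ← integral_Ioc_eq_integral_Ioo,
        ← intervalIntegral.integral_of_le h1.le, integral_inv_of_pos hε one_pos]
      simp
    rw [h2, hb, mul_assoc, mul_assoc]
    gcongr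
    rw [← h4]; exact h3
  refine ⟨Real.exp (-(|A| / b + 1)), Real.exp_pos _, ?_, ?_⟩
  · rw [Real.exp_lt_one_iff]
    have : 0 ≤ |A| / b := by positivity
    linarith
  · refine le_trans ?_ (key _ (Real.exp_pos _) ?_)
    · rw [Real.log_exp, neg_neg, mul_add, mul_div_cancel₀ _ hbpos.ne']
      linarith [le_abs_self A]
    · rw [Real.exp_lt_one_iff]
      have : 0 ≤ |A| / b := by positivity
      linarith

/-- A set of small measure carries, uniformly as `ε → 0`, much less of the regularised kernel
than the unit ball. -/
lemma exists_setIntegral_regKernel_le (hN : 1 ≤ N) (A : ℝ) :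
    ∃ m : ℝ, 0 < m ∧ ∃ ε₀ : ℝ, 0 < ε₀ ∧ ∀ ε, 0 < ε → ε ≤ ε₀ → ∀ S : Set (Space N),
      MeasurableSet S → volume S ≤ ENNReal.ofReal m → ∀ y : Space N,
        ∫ x in S, regKernel N ε (x - y) ≤ regMass N ε - A := by
  obtain ⟨ε₀, h0, h1, hA⟩ := exists_le_regMass hN (A + 1)
  -- `M` bounds the kernel at scale `ε₀`, and `cConst N` bounds it outside the unit ball; the set
  -- may cost at most `1` in total.
  set M : ℝ := cConst N / ε₀ ^ N with hM
  have hc := cConst_pos hN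
  have hMpos : 0 < M := by positivity
  refine ⟨1 / (M + cConst N), by positivity, ε₀, h0, ?_⟩
  intro ε hε hεε S hS hSm y
  have hSfin : volume S ≠ ⊤ := ne_top_of_le_ne_top ENNReal.ofReal_ne_top hSm
  have hreal : volume.real S ≤ 1 / (M + cConst N) :=
    ENNReal.toReal_le_of_le_ofReal (by positivity) hSm
  have hi1 : Integrable (fun x => regK N ε (x - y)) := (integrable_regK hN hε).comp_sub_right y
  have hi0 : Integrable (fun x => regK N ε₀ (x - y)) := (integrable_regK hN h0).comp_sub_right y
  have hle : ∀ z, regK N ε₀ z ≤ regK N ε z := fun z =>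
    Set.indicator_le_indicator (regKernel_anti_right hN hε hεε z)
  have hmass : regMass N ε = (∫ x in S, regK N ε (x - y)) + ∫ x in Sᶜ, regK N ε (x - y) := by
    rw [← integral_regK, ← integral_sub_right_eq_self _ y]
    exact (integral_add_compl hS hi1).symm
  have hmass0 : regMass N ε₀ = (∫ x in S, regK N ε₀ (x - y)) + ∫ x in Sᶜ, regK N ε₀ (x - y) := by
    rw [← integral_regK, ← integral_sub_right_eq_self _ y]
    exact (integral_add_compl hS hi0).symm
  have hcompl : ∫ x in Sᶜ, regK N ε₀ (x - y) ≤ ∫ x in Sᶜ, regK N ε (x - y) :=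
    integral_mono hi0.integrableOn hi1.integrableOn fun x => hle _
  have hS0 : ∫ x in S, regK N ε₀ (x - y) ≤ M * volume.real S := by
    refine (le_abs_self _).trans ?_
    exact norm_setIntegral_le_of_norm_le_const hSfin.lt_top fun x _ => abs_regK_le hN h0 _
  have hJ : IntegrableOn (fun x => kernelJ N (x - y)) S :=
    Measure.integrableOn_of_bounded (M := cConst N) hSfin
      (measurable_kernelJ.comp (by fun_prop)).aestronglyMeasurable
      (Eventually.of_forall fun x => by
        rw [Real.norm_of_nonneg (kernelJ_nonneg hN _)]; exact kernelJ_le hN _)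
  have hJle : ∫ x in S, kernelJ N (x - y) ≤ cConst N * volume.real S := by
    refine (le_abs_self _).trans ?_
    rw [← Real.norm_eq_abs]
    refine norm_setIntegral_le_of_norm_le_const hSfin.lt_top fun x _ => ?_
    rw [Real.norm_of_nonneg (kernelJ_nonneg hN _)]; exact kernelJ_le hN _
  have hsplit : ∫ x in S, regKernel N ε (x - y)
      = (∫ x in S, regK N ε (x - y)) + ∫ x in S, kernelJ N (x - y) := by
    rw [← integral_add hi1.integrableOn hJ]
    refine integral_congr_ae (Eventually.of_forall fun x => ?_)
    exact regKernel_eq_add (hεε.trans_lt h1) _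
  have : (M + cConst N) * volume.real S ≤ 1 := by
    calc (M + cConst N) * volume.real S ≤ (M + cConst N) * (1 / (M + cConst N)) := by gcongr
      _ = 1 := by field_simp
  rw [hsplit]
  linarith

/-! ### Quadratic forms with a convolution kernel -/

section Kernel

variable {κ u φ : Space N → ℝ}

lemma integrable_mul_mul_of_bounded (hu : Integrable u) (hφ : Integrable φ) (hκ : Measurable κ)
    {C : ℝ} (hC : ∀ z, ‖κ z‖ ≤ C) :
    Integrable (fun p : Space N × Space N => u p.1 * φ p.2 * κ (p.1 - p.2)) :=
  (hu.mul_prod hφ).mul_bdd (hκ.comp (by fun_prop)).aestronglyMeasurable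
    (Eventually.of_forall fun _ => hC _)

lemma integrable_snd_mul_kernel (hu : Integrable u) (hκ : Integrable κ) :
    Integrable (fun p : Space N × Space N => u p.2 * κ (p.1 - p.2)) := by
  rw [Measure.volume_eq_prod]
  exact Integrable.convolution_integrand (ContinuousLinearMap.mul ℝ ℝ) hu hκ

lemma integral_snd_mul_kernel (hu : Integrable u) (hκ : Integrable κ) :
    ∫ p : Space N × Space N, u p.2 * κ (p.1 - p.2) = (∫ z, κ z) * ∫ x, u x := by
  have h := integrable_snd_mul_kernel hu hκ
  have := integral_prod_symm (μ := (volume : Measure (Space N))) (ν := volume) _ h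
  rw [Measure.volume_eq_prod, this]
  simp only [integral_const_mul, integral_sub_right_eq_self κ]
  rw [integral_mul_const, mul_comm]

lemma integrable_fst_mul_kernel (hu : Integrable u) (hκ : Integrable κ) (he : ∀ z, κ (-z) = κ z) :
    Integrable (fun p : Space N × Space N => u p.1 * κ (p.1 - p.2)) := by
  have := (integrable_snd_mul_kernel hu hκ).swap
  refine this.congr (Eventually.of_forall fun p => ?_)
  simp only [Function.comp, Prod.fst_swap, Prod.snd_swap]
  rw [← he, neg_sub]

lemma integral_fst_mul_kernel (hu : Integrable u) (hκ : Integrable κ) (he : ∀ z, κ (-z) = κ z) :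
    ∫ p : Space N × Space N, u p.1 * κ (p.1 - p.2) = (∫ z, κ z) * ∫ x, u x := by
  rw [← integral_snd_mul_kernel hu hκ, Measure.volume_eq_prod, ← integral_prod_swap]
  refine integral_congr_ae (Eventually.of_forall fun p => ?_)
  simp only [Prod.fst_swap, Prod.snd_swap]
  rw [← he, neg_sub]

lemma integral_swap_mul_kernel (he : ∀ z, κ (-z) = κ z) :
    ∫ p : Space N × Space N, u p.2 * φ p.1 * κ (p.1 - p.2)
      = ∫ p : Space N × Space N, u p.1 * φ p.2 * κ (p.1 - p.2) := by
  rw [Measure.volume_eq_prod, ← integral_prod_swap]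
  refine integral_congr_ae (Eventually.of_forall fun p => ?_)
  simp only [Prod.fst_swap, Prod.snd_swap]
  rw [← he, neg_sub]

/-- For a bounded integrable kernel the energy splits into a local and a nonlocal term. -/
lemma integral_diff_mul_diff_mul_kernel (hu : Integrable u) (hφ : Integrable φ)
    (huφ : Integrable fun x => u x * φ x) (hκm : Measurable κ) {C : ℝ} (hC : ∀ z, ‖κ z‖ ≤ C)
    (hκ : Integrable κ) (he : ∀ z, κ (-z) = κ z) :
    ∫ p : Space N × Space N, (u p.1 - u p.2) * (φ p.1 - φ p.2) * κ (p.1 - p.2)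
      = 2 * ((∫ z, κ z) * (∫ x, u x * φ x)
        - ∫ p : Space N × Space N, u p.1 * φ p.2 * κ (p.1 - p.2)) := by
  have i1 := integrable_fst_mul_kernel huφ hκ he
  have i2 := integrable_snd_mul_kernel huφ hκ
  have i3 := integrable_mul_mul_of_bounded hu hφ hκm hC
  have i4 : Integrable (fun p : Space N × Space N => u p.2 * φ p.1 * κ (p.1 - p.2)) := by
    refine (integrable_mul_mul_of_bounded hφ hu hκm hC).congr (Eventually.of_forall fun p => ?_)
    simp only; ring
  have e : (fun p : Space N × Space N => (u p.1 - u p.2) * (φ p.1 - φ p.2) * κ (p.1 - p.2))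
      = fun p => (u p.1 * φ p.1 * κ (p.1 - p.2) + u p.2 * φ p.2 * κ (p.1 - p.2))
        - (u p.1 * φ p.2 * κ (p.1 - p.2) + u p.2 * φ p.1 * κ (p.1 - p.2)) := by
    ext p; ring
  rw [e, integral_sub (by exact i1.add i2) (by exact i3.add i4), integral_add i1 i2,
    integral_add i3 i4, integral_fst_mul_kernel huφ hκ he, integral_snd_mul_kernel huφ hκ,
    integral_swap_mul_kernel he]
  ring

end Kernel

/-- Young's inequality: a function supported in a set `S` that carries at most the mass `C` of the
translates of the kernel satisfies `∬ φ(x) φ(y) G_ε(x - y) ≤ C ∫ φ²`. -/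
lemma integral_mul_mul_regKernel_le (hN : 1 ≤ N) (hε : 0 < ε) {φ : Space N → ℝ} {S : Set (Space N)}
    (hS : MeasurableSet S) (hSfin : volume S ≠ ⊤) (hφS : ∀ x ∉ S, φ x = 0)
    (hφ : Integrable φ) (hφ2 : Integrable fun x => φ x * φ x) {C : ℝ}
    (hC : ∀ y, ∫ x in S, regKernel N ε (x - y) ≤ C) :
    ∫ p : Space N × Space N, φ p.1 * φ p.2 * regKernel N ε (p.1 - p.2)
      ≤ C * ∫ x, φ x * φ x := by
  set s : Space N → ℝ := S.indicator 1 with hs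
  have hsi : Integrable s := (integrable_indicator_iff hS).2 (integrableOn_const hSfin)
  have hm := (continuous_regKernel (N := N) hε).measurable
  have he : ∀ z : Space N, regKernel N ε (-z) = regKernel N ε z :=
    fun z => regKernel_congr (norm_neg z)
  have i0 := integrable_mul_mul_of_bounded hφ hφ hm (abs_regKernel_le hN hε)
  have i1 := integrable_mul_mul_of_bounded hsi hφ2 hm (abs_regKernel_le hN hε)
  have i2 : Integrable (fun p : Space N × Space N =>
      s p.2 * (φ p.1 * φ p.1) * regKernel N ε (p.1 - p.2)) := by
    refine (integrable_mul_mul_of_bounded hφ2 hsi hm (abs_regKernel_le hN hε)).congr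
      (Eventually.of_forall fun p => ?_)
    simp only; ring
  have hpt : ∀ p : Space N × Space N, φ p.1 * φ p.2 * regKernel N ε (p.1 - p.2)
      ≤ (1 / 2) * (s p.1 * (φ p.2 * φ p.2) * regKernel N ε (p.1 - p.2)
        + s p.2 * (φ p.1 * φ p.1) * regKernel N ε (p.1 - p.2)) := by
    rintro ⟨x, y⟩
    have hk := regKernel_nonneg hN hε (x - y)
    by_cases hx : x ∈ S
    · by_cases hy : y ∈ S
      · simp only [hs, Set.indicator_of_mem hx, Set.indicator_of_mem hy, Pi.one_apply]
        nlinarith [mul_nonneg (sq_nonneg (φ x - φ y)) hk]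
      · simp [hs, hφS y hy, hy]
    · simp [hs, hφS x hx, hx]
  have hone : ∫ p : Space N × Space N, s p.1 * (φ p.2 * φ p.2) * regKernel N ε (p.1 - p.2)
      ≤ C * ∫ x, φ x * φ x := by
    have := integral_prod_symm (μ := (volume : Measure (Space N))) (ν := volume) _ i1
    rw [Measure.volume_eq_prod, this, ← integral_const_mul]
    refine integral_mono i1.integral_prod_right (hφ2.const_mul C) fun y => ?_
    have : ∀ x, s x * (φ y * φ y) * regKernel N ε (x - y)
        = (φ y * φ y) * S.indicator (fun x => regKernel N ε (x - y)) x := by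
      intro x
      by_cases hx : x ∈ S <;> simp [hs, hx]
    simp only [this, integral_const_mul, integral_indicator hS]
    rw [mul_comm]
    exact mul_le_mul_of_nonneg_right (hC y) (mul_self_nonneg _)
  calc _ ≤ ∫ p : Space N × Space N, (1 / 2) * (s p.1 * (φ p.2 * φ p.2) * regKernel N ε (p.1 - p.2)
        + s p.2 * (φ p.1 * φ p.1) * regKernel N ε (p.1 - p.2)) :=
        integral_mono i0 ((i1.add i2).const_mul _) hpt
    _ = ∫ p : Space N × Space N, s p.1 * (φ p.2 * φ p.2) * regKernel N ε (p.1 - p.2) := by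
        have hsw : ∫ p : Space N × Space N, s p.2 * (φ p.1 * φ p.1) * regKernel N ε (p.1 - p.2)
            = ∫ p : Space N × Space N, s p.1 * (φ p.2 * φ p.2) * regKernel N ε (p.1 - p.2) :=
          integral_swap_mul_kernel (u := s) (φ := fun x => φ x * φ x) he
        rw [integral_const_mul, integral_add i1 i2, hsw]
        ring
    _ ≤ _ := hone

end LogLap

namespace LogLap

variable {N : ℕ} {ε : ℝ} {u φ h : Space N → ℝ}

/-! ### The form as a limit of regularised forms -/

/-- The form of the logarithmic Laplacian with the kernel replaced by the regularised one. The
energy part is expanded, which is possible because the regularised kernel is integrable near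
the origin. -/
noncomputable def regForm (ε : ℝ) (u φ : Space N → ℝ) : ℝ :=
  (regMass N ε + rhoConst N) * (∫ x, u x * φ x)
    - ∫ p : Space N × Space N, u p.1 * φ p.2 * regKernel N ε (p.1 - p.2)

lemma MemH.integrable_mul (hu : MemH u) (hφ : MemH φ) : Integrable fun x => u x * φ x :=
  MemLp.integrable_mul hu.1 hφ.1

lemma aestronglyMeasurable_diff (hu : AEStronglyMeasurable u) :
    AEStronglyMeasurable (fun p : Space N × Space N => u p.1 - u p.2) := by
  rw [Measure.volume_eq_prod]
  exact hu.comp_fst.sub hu.comp_snd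

/-- On `ℍ(ℝ^N)` the form is the limit of the regularised forms. -/
lemma tendsto_regForm (hN : 1 ≤ N) (hu : MemH u) (hφ : MemH φ) (hui : Integrable u)
    (hφi : Integrable φ) :
    Tendsto (fun ε => regForm ε u φ) (𝓝[>] 0) (𝓝 (formL u φ)) := by
  have huφ := hu.integrable_mul hφ
  have hlim : Tendsto (fun ε => ∫ p : Space N × Space N,
      (u p.1 - u p.2) * (φ p.1 - φ p.2) * regK N ε (p.1 - p.2)) (𝓝[>] 0)
      (𝓝 (∫ p : Space N × Space N,
        (u p.1 - u p.2) * (φ p.1 - φ p.2) * kernelK N (p.1 - p.2))) := by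
    refine tendsto_integral_filter_of_dominated_convergence
      (fun p => (1 / 2) * ((u p.1 - u p.2) * (u p.1 - u p.2) * kernelK N (p.1 - p.2)
        + (φ p.1 - φ p.2) * (φ p.1 - φ p.2) * kernelK N (p.1 - p.2))) ?_ ?_
      ((hu.2.add hφ.2).const_mul _) ?_
    · filter_upwards [self_mem_nhdsWithin] with ε hε
      exact ((aestronglyMeasurable_diff hu.1.1).mul (aestronglyMeasurable_diff hφ.1.1)).mul
        ((measurable_regK hε).comp (by fun_prop)).aestronglyMeasurable
    · filter_upwards [self_mem_nhdsWithin] with ε hε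
      refine Eventually.of_forall fun p => ?_
      by_cases hp : p.1 = p.2
      · simp [hp]
      · rw [norm_mul, Real.norm_of_nonneg (regK_nonneg hN hε _), ← add_mul, ← mul_assoc]
        refine mul_le_mul ?_ (regK_le_kernelK hN (sub_ne_zero.2 hp)) (regK_nonneg hN hε _) ?_
        · rw [Real.norm_eq_abs, abs_le]
          constructor <;> nlinarith [sq_nonneg ((u p.1 - u p.2) - (φ p.1 - φ p.2)),
            sq_nonneg ((u p.1 - u p.2) + (φ p.1 - φ p.2))]
        · exact mul_nonneg (by norm_num) (add_nonneg (mul_self_nonneg _) (mul_self_nonneg _))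
    · refine Eventually.of_forall fun p => ?_
      by_cases hp : p.1 = p.2
      · simp [hp]
      · have hpos : 0 < ‖p.1 - p.2‖ := norm_pos_iff.2 (sub_ne_zero.2 hp)
        refine tendsto_const_nhds.congr' ?_
        filter_upwards [nhdsWithin_le_nhds (Iio_mem_nhds hpos)] with ε hε
        rw [regK_eq_kernelK (le_of_lt hε)]
  have hfin : Tendsto (fun ε => (1 / 2) * (∫ p : Space N × Space N,
      (u p.1 - u p.2) * (φ p.1 - φ p.2) * regK N ε (p.1 - p.2))
      - (∫ p : Space N × Space N, u p.1 * φ p.2 * kernelJ N (p.1 - p.2))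
      + rhoConst N * ∫ x, u x * φ x) (𝓝[>] 0) (𝓝 (formL u φ)) :=
    ((hlim.const_mul _).sub_const _).add_const _
  refine hfin.congr' ?_
  filter_upwards [Ioo_mem_nhdsGT (zero_lt_one (α := ℝ))] with ε hε
  have hJi : Integrable (fun p : Space N × Space N => u p.1 * φ p.2 * kernelJ N (p.1 - p.2)) :=
    integrable_mul_mul_of_bounded hui hφi measurable_kernelJ (C := cConst N) fun z => by
      rw [Real.norm_of_nonneg (kernelJ_nonneg hN z)]; exact kernelJ_le hN z
  have hKi := integrable_mul_mul_of_bounded hui hφi (measurable_regK (N := N) hε.1)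
    (abs_regK_le hN hε.1)
  rw [integral_diff_mul_diff_mul_kernel hui hφi huφ (measurable_regK hε.1)
    (abs_regK_le hN hε.1) (integrable_regK hN hε.1) regK_neg, integral_regK]
  have : ∫ p : Space N × Space N, u p.1 * φ p.2 * regKernel N ε (p.1 - p.2)
      = (∫ p : Space N × Space N, u p.1 * φ p.2 * regK N ε (p.1 - p.2))
        + ∫ p : Space N × Space N, u p.1 * φ p.2 * kernelJ N (p.1 - p.2) := by
    rw [← integral_add hKi hJi]
    refine integral_congr_ae (Eventually.of_forall fun p => ?_)
    simp only [regKernel_eq_add hε.2, mul_add]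
  rw [regForm, this]
  ring

/-! ### Reflections -/

/-- The reflection of `ℝ^N` in the hyperplane `⟨e, x⟩ = l`, for a unit vector `e`. -/
noncomputable def refl (e : Space N) (l : ℝ) (x : Space N) : Space N :=
  x - (2 * (inner ℝ e x - l)) • e

/-- The open half-space `⟨e, x⟩ > l`. -/
def halfSpace (e : Space N) (l : ℝ) : Set (Space N) := {x | l < inner ℝ e x}

variable {e : Space N} {l : ℝ}

lemma measurableSet_halfSpace : MeasurableSet (halfSpace e l) :=
  (isOpen_lt continuous_const (by fun_prop)).measurableSet

lemma continuous_refl : Continuous (refl e l) := by unfold refl; fun_prop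

lemma inner_refl (he : ‖e‖ = 1) (x : Space N) :
    inner ℝ e (refl e l x) = 2 * l - inner ℝ e x := by
  rw [refl, inner_sub_right, inner_smul_right, real_inner_self_eq_norm_sq, he]
  ring

lemma refl_refl (he : ‖e‖ = 1) (x : Space N) : refl e l (refl e l x) = x := by
  conv_lhs => rw [refl, inner_refl he]
  rw [refl, sub_sub, ← add_smul]
  ring_nf
  simp

lemma refl_eq_self {x : Space N} (hx : inner ℝ e x = l) : refl e l x = x := by
  simp [refl, hx]

lemma refl_mem_halfSpace_iff (he : ‖e‖ = 1) {x : Space N} :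
    refl e l x ∈ halfSpace e l ↔ inner ℝ e x < l := by
  simp only [halfSpace, Set.mem_ofPred_eq, inner_refl he]
  constructor <;> intro h <;> linarith

lemma norm_refl_sub_sq (he : ‖e‖ = 1) (x y : Space N) :
    ‖refl e l x - y‖ ^ 2 = ‖x - y‖ ^ 2 + 4 * (inner ℝ e x - l) * (inner ℝ e y - l) := by
  have : refl e l x - y = (x - y) - (2 * (inner ℝ e x - l)) • e := by
    rw [refl]; abel
  rw [this, norm_sub_sq_real, inner_smul_right, norm_smul, he, real_inner_comm e (x - y),
    inner_sub_right,
    mul_one, Real.norm_eq_abs, sq_abs]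
  ring

lemma norm_refl_sub_comm (he : ‖e‖ = 1) (x y : Space N) :
    ‖refl e l x - y‖ = ‖x - refl e l y‖ := by
  rw [← sq_eq_sq₀ (norm_nonneg _) (norm_nonneg _), norm_refl_sub_sq he,
    norm_sub_rev x (refl e l y), norm_refl_sub_sq he, norm_sub_rev y]
  ring

lemma norm_refl_sub_refl (he : ‖e‖ = 1) (x y : Space N) :
    ‖refl e l x - refl e l y‖ = ‖x - y‖ := by
  rw [norm_refl_sub_comm he, refl_refl he]

lemma norm_sub_le_norm_refl_sub (he : ‖e‖ = 1) {x y : Space N} (hx : x ∈ halfSpace e l)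
    (hy : y ∈ halfSpace e l) : ‖x - y‖ ≤ ‖refl e l x - y‖ := by
  rw [← sq_le_sq₀ (norm_nonneg _) (norm_nonneg _), norm_refl_sub_sq he]
  have h1 : 0 < inner ℝ e x - l := sub_pos.2 hx
  have h2 : 0 < inner ℝ e y - l := sub_pos.2 hy
  nlinarith [mul_pos h1 h2]

lemma norm_refl_le (he : ‖e‖ = 1) (hl : 0 ≤ l) {x : Space N} (hx : x ∈ halfSpace e l) :
    ‖refl e l x‖ ≤ ‖x‖ := by
  rw [← sq_le_sq₀ (norm_nonneg _) (norm_nonneg _)]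
  have := norm_refl_sub_sq (l := l) he x 0
  simp only [sub_zero, inner_zero_right, zero_sub] at this
  have h1 : 0 < inner ℝ e x - l := sub_pos.2 hx
  rw [this]
  nlinarith [mul_nonneg h1.le hl]

lemma measurePreserving_refl (he : ‖e‖ = 1) : MeasurePreserving (refl e l) := by
  have h : refl e l = (fun x => x + (2 * l) • e) ∘ (ℝ ∙ e)ᗮ.reflection := by
    ext1 x
    simp only [Function.comp, Submodule.reflection_orthogonal_apply,
      Submodule.reflection_singleton_apply, he, refl]
    simp only [RCLike.ofReal_one, one_pow, div_one, neg_sub]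
    rw [two_nsmul, sub_add, sub_right_inj, ← add_smul, ← sub_smul]
    ring_nf
  rw [h]
  exact (measurePreserving_add_right volume _).comp
    (LinearIsometryEquiv.measurePreserving _)

lemma measurePreserving_refl_snd (he : ‖e‖ = 1) :
    MeasurePreserving (fun p : Space N × Space N => (p.1, refl e l p.2)) := by
  rw [Measure.volume_eq_prod]
  exact (MeasurePreserving.id _).prod (measurePreserving_refl he)

lemma measurePreserving_refl_refl (he : ‖e‖ = 1) :
    MeasurePreserving (fun p : Space N × Space N => (refl e l p.1, refl e l p.2)) := by
  rw [Measure.volume_eq_prod]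
  exact (measurePreserving_refl he).prod (measurePreserving_refl he)

/-- The reflection as a measurable equivalence. -/
noncomputable def reflEquiv (he : ‖e‖ = 1) (l : ℝ) : Space N ≃ᵐ Space N where
  toFun := refl e l
  invFun := refl e l
  left_inv := refl_refl he
  right_inv := refl_refl he
  measurable_toFun := continuous_refl.measurable
  measurable_invFun := continuous_refl.measurable

lemma integral_comp_refl (he : ‖e‖ = 1) (f : Space N → ℝ) :
    ∫ x, f (refl e l x) = ∫ x, f x :=
  (measurePreserving_refl (l := l) he).integral_comp (reflEquiv he l).measurableEmbedding f

lemma integral_comp_refl_refl (he : ‖e‖ = 1) (f : Space N × Space N → ℝ) :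
    ∫ p : Space N × Space N, f (refl e l p.1, refl e l p.2) = ∫ p, f p :=
  (measurePreserving_refl_refl (l := l) he).integral_comp
    ((reflEquiv he l).prodCongr (reflEquiv he l)).measurableEmbedding f

lemma volume_hyperplane (he : ‖e‖ = 1) : volume {x : Space N | inner ℝ e x = l} = 0 := by
  have hs : ({x : Space N | inner ℝ e x = l} : Set (Space N))
      = (AffineSubspace.mk' (l • e) (ℝ ∙ e)ᗮ : AffineSubspace ℝ (Space N)) := by
    ext x
    simp only [Set.mem_ofPred_eq, SetLike.mem_coe, AffineSubspace.mem_mk', vsub_eq_sub,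
      Submodule.mem_orthogonal_singleton_iff_inner_right, inner_sub_right, inner_smul_right,
      real_inner_self_eq_norm_sq, he]
    constructor <;> intro h <;> linarith
  rw [hs]
  refine Measure.addHaar_affineSubspace _ _ fun htop => ?_
  have : (l + 1) • e ∈ (AffineSubspace.mk' (l • e) (ℝ ∙ e)ᗮ : AffineSubspace ℝ (Space N)) := by
    rw [htop]; trivial
  rw [← SetLike.mem_coe, ← hs] at this
  simp [inner_smul_right, he] at this

/-! ### Functions of finite energy -/

lemma kernelK_congr {z z' : Space N} (hz : ‖z‖ = ‖z'‖) : kernelK N z = kernelK N z' := by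
  simp [kernelK, Set.indicator, hz]

lemma kernelK_anti (hN : 1 ≤ N) {z z' : Space N} (h0 : z ≠ 0) (h : ‖z‖ ≤ ‖z'‖) :
    kernelK N z' ≤ kernelK N z := by
  by_cases hz' : z' ∈ Metric.ball (0 : Space N) 1
  · have hz : z ∈ Metric.ball (0 : Space N) 1 := by
      rw [mem_ball_zero_iff] at *; linarith
    simp only [kernelK, Set.indicator_of_mem hz, Set.indicator_of_mem hz']
    have : 0 < ‖z‖ := norm_pos_iff.2 h0
    exact div_le_div_of_nonneg_left (cConst_pos hN).le (by positivity) (by gcongr)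
  · simp only [kernelK, Set.indicator_of_notMem hz']
    exact kernelK_nonneg hN z

lemma MemH.of_le {G : Space N × Space N → ℝ} (hN : 1 ≤ N) (hφ : MemLp φ 2) (hG : Integrable G)
    (hle : ∀ p : Space N × Space N,
      (φ p.1 - φ p.2) * (φ p.1 - φ p.2) * kernelK N (p.1 - p.2) ≤ G p) : MemH φ := by
  refine ⟨hφ, hG.mono' ?_ (Eventually.of_forall fun p => ?_)⟩
  · exact ((aestronglyMeasurable_diff hφ.1).mul (aestronglyMeasurable_diff hφ.1)).mul
      (measurable_kernelK.comp (by fun_prop)).aestronglyMeasurable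
  · rw [Real.norm_of_nonneg (mul_nonneg (mul_self_nonneg _) (kernelK_nonneg hN _))]
    exact hle p

lemma MemH.sub (hN : 1 ≤ N) (hu : MemH u) (hφ : MemH φ) : MemH fun x => u x - φ x := by
  refine MemH.of_le hN (hu.1.sub hφ.1) ((hu.2.add hφ.2).const_mul 2) fun p => ?_
  simp only [Pi.add_apply, ← add_mul, ← mul_assoc]
  refine mul_le_mul_of_nonneg_right ?_ (kernelK_nonneg hN _)
  nlinarith [sq_nonneg ((u p.1 - u p.2) + (φ p.1 - φ p.2))]

lemma MemH.add (hN : 1 ≤ N) (hu : MemH u) (hφ : MemH φ) : MemH fun x => u x + φ x := by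
  refine MemH.of_le hN (hu.1.add hφ.1) ((hu.2.add hφ.2).const_mul 2) fun p => ?_
  simp only [Pi.add_apply, ← add_mul, ← mul_assoc]
  refine mul_le_mul_of_nonneg_right ?_ (kernelK_nonneg hN _)
  nlinarith [sq_nonneg ((u p.1 - u p.2) - (φ p.1 - φ p.2))]

lemma MemH.comp_refl (he : ‖e‖ = 1) (hu : MemH u) : MemH fun x => u (refl e l x) := by
  refine ⟨hu.1.comp_measurePreserving (measurePreserving_refl he), ?_⟩
  refine ((measurePreserving_refl_refl (l := l) he).integrable_comp_of_integrable hu.2).congr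
    (Eventually.of_forall fun p => ?_)
  simp only [Function.comp]
  rw [kernelK_congr (norm_refl_sub_refl he p.1 p.2)]

/-- The positive part of an antisymmetric function, cut off to the half-space, has finite energy:
across the hyperplane the point `y` is compared with its reflection, which is nearer. -/
lemma MemH.fold (hN : 1 ≤ N) (he : ‖e‖ = 1) (hu : MemH u)
    (hanti : ∀ x, u (refl e l x) = -u x) :
    MemH ((halfSpace e l).indicator fun x => max (u x) 0) := by
  have hL : MemLp ((halfSpace e l).indicator fun x => max (u x) 0) 2 := by
    refine MemLp.indicator measurableSet_halfSpace ?_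
    exact hu.1.pos_part
  have hrefl := (measurePreserving_refl_snd (l := l) he).integrable_comp_of_integrable hu.2
  refine MemH.of_le hN hL (hu.2.add hrefl) fun p => ?_
  obtain ⟨x, y⟩ := p
  simp only [Pi.add_apply, Function.comp]
  set F : Space N → Space N → ℝ := fun x y => (u x - u y) * (u x - u y) * kernelK N (x - y)
    with hF
  have hF0 : ∀ x y, 0 ≤ F x y := fun x y => mul_nonneg (mul_self_nonneg _) (kernelK_nonneg hN _)
  -- the case of points on different sides of the hyperplane
  have hmix : ∀ x y, x ∈ halfSpace e l → y ∉ halfSpace e l →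
      max (u x) 0 * max (u x) 0 * kernelK N (x - y) ≤ F x y + F x (refl e l y) := by
    intro x y hx hy
    by_cases hux : u x ≤ 0
    · rw [max_eq_right hux]
      simpa using add_nonneg (hF0 x y) (hF0 x (refl e l y))
    push Not at hux
    rw [max_eq_left hux.le]
    by_cases huy : u y ≤ 0
    · refine le_add_of_le_of_nonneg ?_ (hF0 _ _)
      refine mul_le_mul_of_nonneg_right ?_ (kernelK_nonneg hN _)
      nlinarith
    · push Not at huy
      have hle : inner ℝ e y ≤ l := not_lt.1 hy
      rcases hle.eq_or_lt with heq | hlt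
      · have := hanti y
        rw [refl_eq_self heq] at this
        linarith
      refine le_add_of_nonneg_of_le (hF0 _ _) ?_
      have hne : x - refl e l y ≠ 0 := by
        intro h0
        have h1 := hanti y
        rw [← sub_eq_zero.1 h0] at h1
        linarith
      have hk : kernelK N (x - y) ≤ kernelK N (x - refl e l y) := by
        refine kernelK_anti hN hne ?_
        have := norm_sub_le_norm_refl_sub he hx ((refl_mem_halfSpace_iff he).2 hlt)
        rwa [norm_refl_sub_refl he] at this
      refine mul_le_mul ?_ hk (kernelK_nonneg hN _) (mul_self_nonneg _)
      rw [hanti]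
      nlinarith
  by_cases hx : x ∈ halfSpace e l
  · by_cases hy : y ∈ halfSpace e l
    · simp only [Set.indicator_of_mem hx, Set.indicator_of_mem hy]
      refine le_add_of_le_of_nonneg ?_ (hF0 x (refl e l y))
      refine mul_le_mul_of_nonneg_right ?_ (kernelK_nonneg hN _)
      rw [← sq, ← sq, sq_le_sq]
      exact abs_max_sub_max_le_abs _ _ _
    · simp only [Set.indicator_of_mem hx, Set.indicator_of_notMem hy, sub_zero]
      exact hmix x y hx hy
  · by_cases hy : y ∈ halfSpace e l
    · simp only [Set.indicator_of_notMem hx, Set.indicator_of_mem hy, zero_sub, neg_mul_neg]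
      have h := hmix y x hy hx
      have e1 : F y x = F x y := by
        simp only [hF]; rw [kernelK_congr (norm_sub_rev y x)]; ring
      have e2 : F y (refl e l x) = F x (refl e l y) := by
        simp only [hF]
        rw [hanti, hanti, kernelK_congr (z := y - refl e l x) (z' := x - refl e l y)]
        · ring
        · rw [norm_sub_rev, norm_refl_sub_comm he]
      rw [e1, e2] at h
      rw [kernelK_congr (norm_sub_rev y x)] at h
      exact h
    · simp only [Set.indicator_of_notMem hx, Set.indicator_of_notMem hy, sub_zero, zero_mul]
      exact add_nonneg (hF0 x y) (hF0 x (refl e l y))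

lemma integrable_norm_mul_kernelK (hN : 1 ≤ N) :
    Integrable (fun z : Space N => ‖z‖ * kernelK N z) := by
  have := nontrivial_space hN
  set g : ℝ → ℝ := (Set.Iio 1).indicator fun r => r * (cConst N / r ^ N) with hg
  have hgz : ∀ z : Space N, g ‖z‖ = ‖z‖ * kernelK N z := by
    intro z
    simp [kernelK, hg, Set.indicator]
  refine Integrable.congr ?_ (Eventually.of_forall hgz)
  rw [integrable_fun_norm_addHaar (volume : Measure (Space N)) (f := g)]
  have h1 : Integrable ((Set.Ioo (0 : ℝ) 1).indicator fun _ => cConst N) :=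
    (integrable_indicator_iff measurableSet_Ioo).2 (integrableOn_const (by simp))
  refine h1.integrableOn.congr_fun (fun y hy => ?_) measurableSet_Ioi
  have hy : 0 < y := hy
  by_cases hy1 : y < 1
  · have : y ∈ Set.Ioo (0 : ℝ) 1 := ⟨hy, hy1⟩
    rw [Set.indicator_of_mem this]
    simp only [hg, finrank_euclideanSpace, Fintype.card_fin, smul_eq_mul]
    rw [Set.indicator_of_mem (show y ∈ Set.Iio (1 : ℝ) from hy1)]
    obtain ⟨n, rfl⟩ : ∃ n, N = n + 1 := ⟨N - 1, by omega⟩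
    simp only [Nat.add_sub_cancel, pow_succ]
    field_simp
  · have : y ∉ Set.Ioo (0 : ℝ) 1 := fun h => hy1 h.2
    rw [Set.indicator_of_notMem this]
    simp only [hg]
    rw [Set.indicator_of_notMem (show y ∉ Set.Iio (1 : ℝ) from hy1), smul_zero]

lemma memH_of_lipschitz (hN : 1 ≤ N) {C : ℝ} (hu : ∀ x y, |u x - u y| ≤ C * ‖x - y‖)
    (hcont : Continuous u) (hsupp : HasCompactSupport u) : MemH u := by
  have hK := hsupp.isCompact
  set s : Space N → ℝ := (tsupport u).indicator 1 with hs
  have hsi : Integrable s :=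
    (integrable_indicator_iff hK.measurableSet).2 (integrableOn_const hK.measure_lt_top.ne)
  have he : ∀ z : Space N, ‖-z‖ * kernelK N (-z) = ‖z‖ * kernelK N z := fun z => by
    rw [norm_neg, kernelK_congr (norm_neg z)]
  have i1 := integrable_fst_mul_kernel hsi (integrable_norm_mul_kernelK hN) he
  have i2 := integrable_snd_mul_kernel hsi (integrable_norm_mul_kernelK hN)
  refine MemH.of_le hN (hcont.memLp_of_hasCompactSupport hsupp) ((i1.add i2).const_mul (C ^ 2))
    fun p => ?_
  obtain ⟨x, y⟩ := p
  simp only [Pi.add_apply, ← add_mul, ← mul_assoc]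
  have hs0 : ∀ x, 0 ≤ s x := fun x => Set.indicator_nonneg (fun _ _ => zero_le_one) _
  have hs1 : ∀ x, u x ≠ 0 → s x = 1 := fun x hx => by
    simp [hs, subset_tsupport u (Function.mem_support.2 hx)]
  by_cases h0 : u x = 0 ∧ u y = 0
  · simp only [h0.1, h0.2, sub_self, zero_mul]
    have := kernelK_nonneg hN (x - y)
    have := hs0 x; have := hs0 y
    positivity
  have hsum : 1 ≤ s x + s y := by
    rw [not_and_or] at h0
    rcases h0 with h | h
    · linarith [hs1 x h, hs0 y]
    · linarith [hs1 y h, hs0 x]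
  by_cases hz : x - y ∈ Metric.ball (0 : Space N) 1
  · refine mul_le_mul_of_nonneg_right ?_ (kernelK_nonneg hN _)
    have h1 : ‖x - y‖ ≤ 1 := (mem_ball_zero_iff.1 hz).le
    have h2 := mul_self_le_mul_self (abs_nonneg _) (hu x y)
    rw [abs_mul_abs_self] at h2
    calc (u x - u y) * (u x - u y) ≤ C * ‖x - y‖ * (C * ‖x - y‖) := h2
      _ = C ^ 2 * 1 * (‖x - y‖ * ‖x - y‖) := by ring
      _ ≤ C ^ 2 * (s x + s y) * (‖x - y‖ * 1) := by gcongr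
      _ = C ^ 2 * (s x + s y) * ‖x - y‖ := by ring
  · have : kernelK N (x - y) = 0 := Set.indicator_of_notMem hz _
    simp [this]

end LogLap

namespace LogLap

variable {N : ℕ} {ε : ℝ} {u φ g : Space N → ℝ} {e : Space N} {l : ℝ}

/-! ### The comparison principle for antisymmetric differences -/

lemma regForm_comp_refl (he : ‖e‖ = 1) :
    regForm ε u (fun x => φ (refl e l x)) = regForm ε (fun x => u (refl e l x)) φ := by
  have h1 : ∫ x, u x * φ (refl e l x) = ∫ x, u (refl e l x) * φ x := by
    rw [← integral_comp_refl (l := l) he]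
    simp only [refl_refl he]
  have h2 : ∫ p : Space N × Space N, u p.1 * φ (refl e l p.2) * regKernel N ε (p.1 - p.2)
      = ∫ p : Space N × Space N, u (refl e l p.1) * φ p.2 * regKernel N ε (p.1 - p.2) := by
    rw [← integral_comp_refl_refl (l := l) he]
    refine integral_congr_ae (Eventually.of_forall fun p => ?_)
    simp only [refl_refl he]
    rw [regKernel_congr (norm_refl_sub_refl he p.1 p.2)]
  rw [regForm, regForm, h1, h2]

lemma regForm_sub (hN : 1 ≤ N) (hε : 0 < ε) {v : Space N → ℝ} (hu : Integrable u)
    (hv : Integrable v) (hφ : Integrable φ) (huφ : Integrable fun x => u x * φ x)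
    (hvφ : Integrable fun x => v x * φ x) :
    regForm ε (fun x => v x - u x) φ = regForm ε v φ - regForm ε u φ := by
  have hm := (continuous_regKernel (N := N) hε).measurable
  have i1 := integrable_mul_mul_of_bounded hu hφ hm (abs_regKernel_le hN hε)
  have i2 := integrable_mul_mul_of_bounded hv hφ hm (abs_regKernel_le hN hε)
  simp only [regForm, sub_mul]
  rw [integral_sub hvφ huφ, integral_sub i2 i1]
  ring

lemma integrable_comp_refl (he : ‖e‖ = 1) (hu : Integrable u) :
    Integrable fun x => u (refl e l x) :=
  (measurePreserving_refl he).integrable_comp_of_integrable hu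

/-- The difference `u ∘ σ - u` of a weak solution and its reflection solves, in the limit of
regularised forms, the equation with the difference of the right-hand sides. -/
lemma tendsto_regForm_refl_sub (hN : 1 ≤ N) (he : ‖e‖ = 1) {Ω : Set (Space N)} {C : ℝ}
    (hu : MemH u) (hui : Integrable u)
    (hweak : ∀ φ, MemHOn Ω φ → (∀ x, 0 ≤ φ x) → formL u φ = ∫ x, g x * φ x)
    (hgm : AEStronglyMeasurable g) (hgC : ∀ x, ‖g x‖ ≤ C)
    (hφ : MemHOn Ω φ) (hφσ : MemHOn Ω fun x => φ (refl e l x)) (hφ0 : ∀ x, 0 ≤ φ x)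
    (hφi : Integrable φ) :
    Tendsto (fun ε => regForm ε (fun x => u (refl e l x) - u x) φ) (𝓝[>] 0)
      (𝓝 (∫ x, (g (refl e l x) - g x) * φ x)) := by
  have hφσi := integrable_comp_refl (l := l) he hφi
  have huσ : MemH fun x => u (refl e l x) := hu.comp_refl he
  have huσi := integrable_comp_refl (l := l) he hui
  have t1 := tendsto_regForm hN hu hφ.1 hui hφi
  have t2 := tendsto_regForm hN hu hφσ.1 hui hφσi
  rw [hweak _ hφ hφ0] at t1
  rw [hweak _ hφσ fun x => hφ0 _] at t2
  have j1 : Integrable fun x => g x * φ x := hφi.bdd_mul hgm (Eventually.of_forall hgC)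
  have j2 : Integrable fun x => g (refl e l x) * φ x :=
    hφi.bdd_mul (hgm.comp_measurePreserving (measurePreserving_refl he))
      (Eventually.of_forall fun x => hgC _)
  have h2 : ∫ x, g x * φ (refl e l x) = ∫ x, g (refl e l x) * φ x := by
    rw [← integral_comp_refl (l := l) he]
    simp only [refl_refl he]
  have hlim : ∫ x, (g (refl e l x) - g x) * φ x
      = (∫ x, g x * φ (refl e l x)) - ∫ x, g x * φ x := by
    simp only [sub_mul]
    rw [h2, integral_sub j2 j1]
  rw [hlim]
  refine (t2.sub t1).congr' ?_
  filter_upwards [self_mem_nhdsWithin] with ε hε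
  rw [regForm_sub hN hε hui huσi hφi (hu.integrable_mul hφ.1) (huσ.integrable_mul hφ.1),
    regForm_comp_refl he]

/-- The amount `(a - w)⁺` by which `w = u ∘ σ - u` fails to lie above `a` in the half-space. -/
noncomputable def deficit (e : Space N) (l : ℝ) (u a : Space N → ℝ) : Space N → ℝ :=
  (halfSpace e l).indicator fun x => max (a x - (u (refl e l x) - u x)) 0

lemma deficit_nonneg (a : Space N → ℝ) (x : Space N) : 0 ≤ deficit e l u a x :=
  Set.indicator_nonneg (fun _ _ => le_max_right _ _) _

lemma refl_notMem_halfSpace (he : ‖e‖ = 1) {x : Space N} (hx : x ∈ halfSpace e l) :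
    refl e l x ∉ halfSpace e l := by
  rw [refl_mem_halfSpace_iff he]
  exact not_lt.2 (le_of_lt hx)

lemma memH_deficit (hN : 1 ≤ N) (he : ‖e‖ = 1) (hu : MemH u) {a : Space N → ℝ} (ha : MemH a)
    (haH : ∀ x ∉ halfSpace e l, a x = 0) : MemH (deficit e l u a) := by
  have hs := ha.add hN hu
  have hb := (hs.sub hN (hs.comp_refl (l := l) he)).fold (l := l) hN he fun x => by
    simp only [refl_refl he]; ring
  convert hb using 1
  refine Set.indicator_congr fun x hx => ?_
  rw [haH _ (refl_notMem_halfSpace he hx)]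
  congr 1; ring

lemma integrable_deficit (hN : 1 ≤ N) (he : ‖e‖ = 1) (hu : MemH u) (hui : Integrable u)
    {a : Space N → ℝ} (ha : MemH a) (hai : Integrable a)
    (haH : ∀ x ∉ halfSpace e l, a x = 0) : Integrable (deficit e l u a) := by
  refine Integrable.mono' (hai.norm.add ((integrable_comp_refl (l := l) he hui).norm.add hui.norm))
    (memH_deficit hN he hu ha haH).1.1 (Eventually.of_forall fun x => ?_)
  rw [Real.norm_of_nonneg (deficit_nonneg a x)]
  refine Set.indicator_le' (fun x _ => ?_) (fun x _ => ?_) x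
  · simp only [Pi.add_apply, Real.norm_eq_abs]
    refine max_le ?_ (by positivity)
    linarith [le_abs_self (a x), neg_abs_le (u (refl e l x)), le_abs_self (u x)]
  · simp only [Pi.add_apply]
    positivity

lemma deficit_of_pos {a : Space N → ℝ} {x : Space N} (hx : deficit e l u a x ≠ 0) :
    x ∈ halfSpace e l ∧ u (refl e l x) - u x = a x - deficit e l u a x := by
  have hxH : x ∈ halfSpace e l := Set.mem_of_indicator_ne_zero hx
  refine ⟨hxH, ?_⟩
  rw [deficit, Set.indicator_of_mem hxH] at hx ⊢
  rcases le_total (a x - (u (refl e l x) - u x)) 0 with h | h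
  · exact absurd (max_eq_right h) hx
  · rw [max_eq_left h]; ring

/-- The function `w + (a - w)⁺` in the half-space, that is `max w a`, extended
antisymmetrically. -/
noncomputable def envelope (e : Space N) (l : ℝ) (u a : Space N → ℝ) (x : Space N) : ℝ :=
  u (refl e l x) - u x + deficit e l u a x - deficit e l u a (refl e l x)

lemma envelope_refl (he : ‖e‖ = 1) (a : Space N → ℝ) (x : Space N) :
    envelope e l u a (refl e l x) = -envelope e l u a x := by
  simp only [envelope, refl_refl he]; ring

lemma envelope_eq_max (he : ‖e‖ = 1) (a : Space N → ℝ) {x : Space N} (hx : x ∈ halfSpace e l) :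
    envelope e l u a x = max (a x) (u (refl e l x) - u x) := by
  rw [envelope, deficit, Set.indicator_of_mem hx,
    Set.indicator_of_notMem (refl_notMem_halfSpace he hx), sub_zero, add_comm, max_add]
  simp

/-- Testing the equation for `w = u ∘ σ - u` with the deficit `φ = (a - w)⁺`: if the regularised
operator applied to the envelope `max w a` is sufficiently negative where `φ > 0`, and `φ` is
supported in a set of small measure, then `φ` vanishes, that is `w ≥ a`. The case `a = 0` is the
maximum principle in sets of small measure; positive barriers `a` give the strong maximum
principle. -/
lemma exists_deficit_ae_eq_zero (hN : 1 ≤ N) {R C L : ℝ} (hu : MemH u) (hui : Integrable u)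
    (hweak : ∀ φ, MemHOn (Metric.ball 0 R) φ → (∀ x, 0 ≤ φ x) → formL u φ = ∫ x, g x * φ x)
    (hgm : AEStronglyMeasurable g) (hgC : ∀ x, ‖g x‖ ≤ C) (hL : 0 ≤ L)
    (hgL : ∀ x y, |g x - g y| ≤ L * |u x - u y|) :
    ∃ m : ℝ, 0 < m ∧ ∀ (e : Space N) (l : ℝ) (a : Space N → ℝ) (S : Set (Space N)),
      ‖e‖ = 1 → 0 ≤ l → MemH a → Integrable a → (∀ x, 0 ≤ a x) →
      (∀ x ∉ halfSpace e l, a x = 0) →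
      (∀ x ∉ Metric.ball (0 : Space N) R, deficit e l u a x = 0) →
      MeasurableSet S → volume S ≤ ENNReal.ofReal m → (∀ x ∉ S, deficit e l u a x = 0) →
      (∀ᶠ ε in 𝓝[>] (0 : ℝ), ∀ y, deficit e l u a y ≠ 0 →
        (regMass N ε + rhoConst N + L) * a y
          ≤ ∫ x, envelope e l u a x * regKernel N ε (x - y)) →
      deficit e l u a =ᵐ[volume] 0 := by
  obtain ⟨m, hm, ε₀, hε₀, hmε⟩ := exists_setIntegral_regKernel_le hN (L - rhoConst N + 1)
  refine ⟨m, hm, fun e l a S he hl ha hai ha0 haH hB hS hSm hφS hkey => ?_⟩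
  have hSfin : volume S ≠ ⊤ := ne_top_of_le_ne_top ENNReal.ofReal_ne_top hSm
  set φ := deficit e l u a with hφdef
  set z := envelope e l u a with hz
  set w : Space N → ℝ := fun x => u (refl e l x) - u x with hw
  have hφ0 : ∀ x, 0 ≤ φ x := deficit_nonneg a
  have hφ : MemH φ := memH_deficit hN he hu ha haH
  have hφi : Integrable φ := integrable_deficit hN he hu hui ha hai haH
  have hφσi : Integrable fun x => φ (refl e l x) := integrable_comp_refl he hφi
  have hwi : Integrable w := (integrable_comp_refl he hui).sub hui
  have hzi : Integrable z := (hwi.add hφi).sub hφσi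
  have hφφ := hφ.integrable_mul hφ
  have haφ := ha.integrable_mul hφ
  have hφB : MemHOn (Metric.ball 0 R) φ := ⟨hφ, Eventually.of_forall hB⟩
  have hφσB : MemHOn (Metric.ball 0 R) fun x => φ (refl e l x) := by
    refine ⟨hφ.comp_refl he, Eventually.of_forall fun x hx => ?_⟩
    by_contra hne
    have hxH : refl e l x ∈ halfSpace e l := (deficit_of_pos hne).1
    have hxB : refl e l x ∈ Metric.ball (0 : Space N) R := by
      by_contra h; exact hne (hB _ h)
    have := norm_refl_le he hl hxH
    rw [refl_refl he] at this
    rw [mem_ball_zero_iff] at hx hxB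
    linarith
  have hlim := tendsto_regForm_refl_sub hN he hu hui hweak hgm hgC hφB hφσB hφ0 hφi
  -- upper bound for the regularised forms
  have hup : ∫ x, (g (refl e l x) - g x) * φ x
      ≤ -(L * ∫ x, a x * φ x) - (L + 1) * ∫ x, φ x * φ x := by
    refine le_of_tendsto hlim ?_
    filter_upwards [hkey, Ioo_mem_nhdsGT hε₀] with ε hkε hε
    have hmeas := (continuous_regKernel (N := N) hε.1).measurable
    have hb := abs_regKernel_le hN hε.1
    have i1 := integrable_mul_mul_of_bounded hzi hφi hmeas hb
    have i2 := integrable_mul_mul_of_bounded hφi hφi hmeas hb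
    have i3 := integrable_mul_mul_of_bounded hφσi hφi hmeas hb
    have e1 : ∫ x, w x * φ x = (∫ x, a x * φ x) - ∫ x, φ x * φ x := by
      rw [← integral_sub haφ hφφ]
      refine integral_congr_ae (Eventually.of_forall fun x => ?_)
      by_cases hx : φ x = 0
      · simp [hx]
      · simp only [hw, (deficit_of_pos hx).2]; ring
    have e2 : ∫ p : Space N × Space N, w p.1 * φ p.2 * regKernel N ε (p.1 - p.2)
        = (∫ p : Space N × Space N, z p.1 * φ p.2 * regKernel N ε (p.1 - p.2))
          - (∫ p : Space N × Space N, φ p.1 * φ p.2 * regKernel N ε (p.1 - p.2))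
          + ∫ p : Space N × Space N, φ (refl e l p.1) * φ p.2 * regKernel N ε (p.1 - p.2) := by
      rw [← integral_sub i1 i2, ← integral_add (by exact i1.sub i2) i3]
      refine integral_congr_ae (Eventually.of_forall fun p => ?_)
      simp only [hz, hw, envelope]
      ring
    have e3 : 0 ≤ ∫ p : Space N × Space N,
        φ (refl e l p.1) * φ p.2 * regKernel N ε (p.1 - p.2) :=
      integral_nonneg fun p => mul_nonneg (mul_nonneg (hφ0 _) (hφ0 _))
        (regKernel_nonneg hN hε.1 _)
    have e4 : ∫ p : Space N × Space N, φ p.1 * φ p.2 * regKernel N ε (p.1 - p.2)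
        ≤ (regMass N ε - (L - rhoConst N + 1)) * ∫ x, φ x * φ x :=
      integral_mul_mul_regKernel_le hN hε.1 hS hSfin hφS hφi hφφ
        (hmε ε hε.1 hε.2.le S hS hSm)
    have e5 : (regMass N ε + rhoConst N + L) * ∫ x, a x * φ x
        ≤ ∫ p : Space N × Space N, z p.1 * φ p.2 * regKernel N ε (p.1 - p.2) := by
      have := integral_prod_symm (μ := (volume : Measure (Space N))) (ν := volume) _ i1
      rw [Measure.volume_eq_prod, this, ← integral_const_mul]
      refine integral_mono (haφ.const_mul _) i1.integral_prod_right fun y => ?_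
      have e6 : ∀ x, z x * φ y * regKernel N ε (x - y)
          = φ y * (z x * regKernel N ε (x - y)) := fun x => by ring
      simp only [e6, integral_const_mul]
      by_cases hy : φ y = 0
      · simp [hy]
      · have := mul_le_mul_of_nonneg_left (hkε y hy) (hφ0 y)
        linarith
    have : regForm ε w φ = (regMass N ε + rhoConst N) * (∫ x, w x * φ x)
      - ∫ p : Space N × Space N, w p.1 * φ p.2 * regKernel N ε (p.1 - p.2) := rfl
    rw [this, e1, e2]
    linarith
  -- lower bound for the limit
  have hlow : -(L * ∫ x, a x * φ x) - L * ∫ x, φ x * φ x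
      ≤ ∫ x, (g (refl e l x) - g x) * φ x := by
    rw [← integral_const_mul, ← integral_const_mul, ← integral_neg,
      ← integral_sub (by exact (haφ.const_mul L).neg) (hφφ.const_mul L)]
    refine integral_mono ((haφ.const_mul L).neg.sub (hφφ.const_mul L)) ?_ fun x => ?_
    · have hgσ : AEStronglyMeasurable fun x => g (refl e l x) :=
        hgm.comp_measurePreserving (measurePreserving_refl he)
      refine hφi.bdd_mul (c := C + C) (hgσ.sub hgm) (Eventually.of_forall fun x => ?_)
      exact (norm_sub_le _ _).trans (add_le_add (hgC _) (hgC _))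
    · by_cases hx : φ x = 0
      · simp [hx]
      · have h1 := hgL (refl e l x) x
        rw [(deficit_of_pos hx).2, ← hφdef] at h1
        have h2 : |a x - φ x| ≤ a x + φ x := by
          rw [abs_le]
          constructor <;> linarith [ha0 x, hφ0 x]
        have h3 : -(L * (a x + φ x)) ≤ g (refl e l x) - g x := by
          have := neg_abs_le (g (refl e l x) - g x)
          have := mul_le_mul_of_nonneg_left h2 hL
          linarith
        have := mul_le_mul_of_nonneg_right h3 (hφ0 x)
        linarith
  have hzero : ∫ x, φ x * φ x = 0 := by
    refine le_antisymm (by linarith) (integral_nonneg fun x => mul_self_nonneg _)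
  have h := (integral_eq_zero_iff_of_nonneg (fun x => mul_self_nonneg _) hφφ).1 hzero
  filter_upwards [h] with x hx
  exact mul_self_eq_zero.1 hx

end LogLap

namespace LogLap

variable {N : ℕ} {ε : ℝ} {u g : Space N → ℝ} {e : Space N} {l : ℝ}

/-! ### Maximum principles -/

lemma integrable_mul_regKernel (hN : 1 ≤ N) (hε : 0 < ε) (hu : Integrable u) (y : Space N) :
    Integrable fun x => u x * regKernel N ε (x - y) :=
  hu.mul_bdd ((continuous_regKernel hε).comp (by fun_prop)).aestronglyMeasurable
    (Eventually.of_forall fun _ => abs_regKernel_le hN hε _)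

/-- For an antisymmetric function the integral against the kernel folds to the half-space, with
the kernel replaced by its difference under reflection. -/
lemma integral_le_integral_antisymm (hN : 1 ≤ N) (hε : 0 < ε) (he : ‖e‖ = 1) {z q : Space N → ℝ}
    (hz : Integrable z) (hanti : ∀ x, z (refl e l x) = -z x) (hq : Integrable q) (y : Space N)
    (hqz : ∀ x ∈ halfSpace e l,
      q x ≤ z x * (regKernel N ε (x - y) - regKernel N ε (refl e l x - y)))
    (hq0 : ∀ x ∉ halfSpace e l, q x = 0) :
    ∫ x, q x ≤ ∫ x, z x * regKernel N ε (x - y) := by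
  have i1 := integrable_mul_regKernel hN hε hz y
  have i2 : Integrable fun x => z (refl e l x) * regKernel N ε (refl e l x - y) :=
    integrable_comp_refl (l := l) he i1
  have i3 : Integrable fun x => q (refl e l x) := integrable_comp_refl he hq
  have h1 : ∫ x, (q x + q (refl e l x)) ≤ ∫ x, (z x * regKernel N ε (x - y)
      + z (refl e l x) * regKernel N ε (refl e l x - y)) := by
    refine integral_mono (hq.add i3) (i1.add i2) fun x => ?_
    rcases lt_trichotomy (inner ℝ e x) l with h | h | h
    · have hm := (refl_mem_halfSpace_iff (l := l) he).2 h
      have := hqz _ hm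
      rw [refl_refl he, hanti] at this
      simp only
      rw [hq0 x (not_lt.2 h.le), hanti]
      linarith
    · have h0 := hanti x
      rw [refl_eq_self h] at h0
      have hz0 : z x = 0 := by linarith
      simp only
      rw [refl_eq_self h, hq0 x (not_lt.2 h.le), hz0]
      simp
    · have := hqz x h
      simp only
      rw [hq0 _ (refl_notMem_halfSpace he h), hanti]
      linarith
  rw [integral_add hq i3, integral_add i1 i2, integral_comp_refl he,
    integral_comp_refl he fun x => z x * regKernel N ε (x - y)] at h1
  linarith

/-- A continuous nonnegative function `u`, positive exactly in the ball of radius `R`, of finite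
energy, whose logarithmic Laplacian in the ball is a bounded continuous function `g`, the
differences of `g` being at most `L` times those of `u`. -/
structure IsLipschitzSolution (R L : ℝ) (u g : Space N → ℝ) : Prop where
  continuous : Continuous u
  memH : MemH u
  pos : ∀ x ∈ Metric.ball (0 : Space N) R, 0 < u x
  eq_zero : ∀ x ∉ Metric.ball (0 : Space N) R, u x = 0
  weak : ∀ φ, MemHOn (Metric.ball 0 R) φ → (∀ x, 0 ≤ φ x) → formL u φ = ∫ x, g x * φ x
  continuous_rhs : Continuous g
  bounded_rhs : ∃ C, ∀ x, ‖g x‖ ≤ C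
  nonneg_const : 0 ≤ L
  lipschitz_rhs : ∀ x y, |g x - g y| ≤ L * |u x - u y|

namespace IsLipschitzSolution

variable {R L : ℝ}

lemma nonneg (hu : IsLipschitzSolution R L u g) (x : Space N) : 0 ≤ u x := by
  by_cases hx : x ∈ Metric.ball (0 : Space N) R
  · exact (hu.pos x hx).le
  · exact (hu.eq_zero x hx).ge

lemma hasCompactSupport (hu : IsLipschitzSolution R L u g) : HasCompactSupport u := by
  refine HasCompactSupport.intro (isCompact_closedBall (0 : Space N) R) fun x hx => ?_
  exact hu.eq_zero x fun h => hx (Metric.ball_subset_closedBall h)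

lemma integrable (hu : IsLipschitzSolution R L u g) : Integrable u :=
  hu.continuous.integrable_of_hasCompactSupport hu.hasCompactSupport

lemma le_of_deficit_ae_eq_zero (hu : IsLipschitzSolution R L u g) {a : Space N → ℝ}
    (ha : Continuous a) (h : deficit e l u a =ᵐ[volume] 0) {x : Space N} (hx : x ∈ halfSpace e l) :
    a x ≤ u (refl e l x) - u x := by
  have hc : Continuous fun x => max (a x - (u (refl e l x) - u x)) 0 := by
    have h1 : Continuous fun x => u (refl e l x) := hu.continuous.comp continuous_refl
    exact (ha.sub (h1.sub hu.continuous)).max continuous_const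
  have hae : (fun x => max (a x - (u (refl e l x) - u x)) 0)
      =ᵐ[volume.restrict (halfSpace e l)] 0 := by
    filter_upwards [ae_restrict_of_ae h, ae_restrict_mem measurableSet_halfSpace] with x h1 h2
    rwa [deficit, Set.indicator_of_mem h2] at h1
  have hopen : IsOpen (halfSpace e l) := isOpen_lt continuous_const (by fun_prop)
  have := Measure.eqOn_open_of_ae_eq hae hopen hc.continuousOn continuousOn_const hx
  have h2 : max (a x - (u (refl e l x) - u x)) 0 = 0 := this
  have h3 := le_max_left (a x - (u (refl e l x) - u x)) 0
  linarith

/-- The maximum principle in sets of small measure: if the set where `u` exceeds its reflection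
is small, it is empty. -/
lemma exists_small_maximum_principle (hN : 1 ≤ N) (hu : IsLipschitzSolution R L u g) :
    ∃ m : ℝ, 0 < m ∧ ∀ (e : Space N) (l : ℝ), ‖e‖ = 1 → 0 ≤ l →
      volume {x | x ∈ halfSpace e l ∧ u (refl e l x) < u x} ≤ ENNReal.ofReal m →
      ∀ x ∈ halfSpace e l, u x ≤ u (refl e l x) := by
  obtain ⟨C, hC⟩ := hu.bounded_rhs
  obtain ⟨m, hm, H⟩ := exists_deficit_ae_eq_zero hN hu.memH hu.integrable hu.weak
    hu.continuous_rhs.aestronglyMeasurable hC hu.nonneg_const hu.lipschitz_rhs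
  refine ⟨m, hm, fun e l he hl hvol x hx => ?_⟩
  have hmeas : MeasurableSet {x | x ∈ halfSpace e l ∧ u (refl e l x) < u x} :=
    measurableSet_halfSpace.inter
      (measurableSet_lt (hu.continuous.comp continuous_refl).measurable hu.continuous.measurable)
  have h0 : MemH (fun _ : Space N => (0 : ℝ)) := by
    have := hu.memH.sub hN hu.memH
    simpa using this
  have hdef : ∀ x, deficit e l u (fun _ => 0) x ≠ 0 →
      x ∈ halfSpace e l ∧ u (refl e l x) < u x := by
    intro x hx
    obtain ⟨h1, h2⟩ := deficit_of_pos hx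
    refine ⟨h1, ?_⟩
    have := lt_of_le_of_ne (deficit_nonneg _ x) hx.symm
    linarith
  have hz := H e l (fun _ => 0) _ he hl h0 (integrable_zero _ _ _) (fun _ => le_rfl)
    (fun _ _ => rfl) (fun x hx => ?_) hmeas hvol (fun x hx => ?_) ?_
  · have := hu.le_of_deficit_ae_eq_zero continuous_const hz hx
    linarith
  · by_contra h
    have := (hdef x h).2
    rw [hu.eq_zero x hx] at this
    linarith [hu.nonneg (refl e l x)]
  · by_contra h
    exact hx (hdef x h)
  · filter_upwards [self_mem_nhdsWithin] with ε hε y hy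
    have hyH := (hdef y hy).1
    have hzi : Integrable (envelope e l u fun _ => 0) := by
      have i1 := integrable_comp_refl (l := l) he hu.integrable
      have i2 : Integrable (deficit e l u fun _ => 0) :=
        integrable_deficit hN he hu.memH hu.integrable h0 (integrable_zero _ _ _) fun _ _ => rfl
      exact ((i1.sub hu.integrable).add i2).sub (integrable_comp_refl he i2)
    have := integral_le_integral_antisymm hN hε he (q := fun _ => 0) hzi (envelope_refl he _)
      (integrable_zero _ _ _) y (fun x hx => ?_) fun _ _ => rfl
    · simpa using this
    · refine mul_nonneg ?_ (sub_nonneg.2 ?_)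
      · rw [envelope_eq_max he _ hx]
        exact le_max_left _ _
      · exact regKernel_anti hN hε (norm_sub_le_norm_refl_sub he hx hyH)

end IsLipschitzSolution

/-- A cone of radius `r` and slope `t` with its tip above `x₀`, the barrier in the strong maximum
principle. -/
noncomputable def cone (x₀ : Space N) (r t : ℝ) (x : Space N) : ℝ := t * max (r - ‖x - x₀‖) 0

section Cone

variable {x₀ : Space N} {r t : ℝ}

lemma continuous_cone : Continuous (cone x₀ r t) := by unfold cone; fun_prop

lemma cone_nonneg (ht : 0 ≤ t) (x : Space N) : 0 ≤ cone x₀ r t x :=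
  mul_nonneg ht (le_max_right _ _)

lemma cone_le (ht : 0 ≤ t) (hr : 0 ≤ r) (x : Space N) : cone x₀ r t x ≤ t * r :=
  mul_le_mul_of_nonneg_left (max_le (by linarith [norm_nonneg (x - x₀)]) hr) ht

lemma cone_eq_zero {x : Space N} (hx : x ∉ Metric.ball x₀ r) : cone x₀ r t x = 0 := by
  have : r ≤ ‖x - x₀‖ := by simpa [dist_eq_norm] using hx
  rw [cone, max_eq_right (by linarith), mul_zero]

lemma hasCompactSupport_cone : HasCompactSupport (cone x₀ r t) :=
  HasCompactSupport.intro (isCompact_closedBall x₀ r) fun _ hx =>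
    cone_eq_zero fun h => hx (Metric.ball_subset_closedBall h)

lemma abs_cone_sub_le (ht : 0 ≤ t) (x y : Space N) :
    |cone x₀ r t x - cone x₀ r t y| ≤ t * ‖x - y‖ := by
  rw [cone, cone, ← mul_sub, abs_mul, abs_of_nonneg ht]
  refine mul_le_mul_of_nonneg_left ((abs_max_sub_max_le_abs _ _ _).trans ?_) ht
  have h : r - ‖x - x₀‖ - (r - ‖y - x₀‖) = ‖y - x₀‖ - ‖x - x₀‖ := by ring
  rw [h]
  refine (abs_norm_sub_norm_le _ _).trans_eq ?_
  rw [sub_sub_sub_cancel_right, norm_sub_rev]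

/-- The regularised operator applied to a cone is bounded, uniformly in `ε`, by the slope. -/
lemma regMass_mul_cone_sub_le (hN : 1 ≤ N) (hε : 0 < ε) (h1 : ε < 1) (ht : 0 ≤ t) (y : Space N) :
    regMass N ε * cone x₀ r t y - ∫ x, cone x₀ r t x * regKernel N ε (x - y)
      ≤ t * ∫ z : Space N, ‖z‖ * kernelK N z := by
  have hci : Integrable (cone x₀ r t) :=
    continuous_cone.integrable_of_hasCompactSupport hasCompactSupport_cone
  have hK : Integrable fun x => regK N ε (x - y) := (integrable_regK hN hε).comp_sub_right y
  have i0 := integrable_mul_regKernel hN hε hci y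
  have i1 : Integrable fun x => cone x₀ r t x * regK N ε (x - y) :=
    hci.mul_bdd ((measurable_regK hε).comp (by fun_prop)).aestronglyMeasurable
      (Eventually.of_forall fun _ => abs_regK_le hN hε _)
  have hmass : regMass N ε * cone x₀ r t y = ∫ x, cone x₀ r t y * regK N ε (x - y) := by
    rw [integral_const_mul, integral_sub_right_eq_self, integral_regK, mul_comm]
  have hle : ∫ x, cone x₀ r t x * regK N ε (x - y)
      ≤ ∫ x, cone x₀ r t x * regKernel N ε (x - y) := by
    refine integral_mono i1 i0 fun x => mul_le_mul_of_nonneg_left ?_ (cone_nonneg ht x)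
    rw [regKernel_eq_add h1]
    linarith [kernelJ_nonneg hN (x - y)]
  calc _ ≤ (∫ x, cone x₀ r t y * regK N ε (x - y)) - ∫ x, cone x₀ r t x * regK N ε (x - y) := by
        rw [hmass]; linarith
    _ = ∫ x, (cone x₀ r t y - cone x₀ r t x) * regK N ε (x - y) := by
        simp only [sub_mul]
        rw [integral_sub (hK.const_mul _) i1]
    _ ≤ ∫ x, t * (‖x - y‖ * kernelK N (x - y)) := by
        have i2 := (integrable_norm_mul_kernelK hN).comp_sub_right y
        refine integral_mono ?_ (i2.const_mul t) fun x => ?_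
        · simp only [sub_mul]
          exact (hK.const_mul _).sub i1
        by_cases hx : x = y
        · simp [hx]
        · simp only
          rw [← mul_assoc]
          refine mul_le_mul ?_ (regK_le_kernelK hN (sub_ne_zero.2 hx)) (regK_nonneg hN hε _)
            (by positivity)
          rw [norm_sub_rev x y]
          exact (le_abs_self _).trans (abs_cone_sub_le ht y x)
    _ = t * ∫ z : Space N, ‖z‖ * kernelK N z := by
        rw [integral_const_mul, integral_sub_right_eq_self fun z : Space N => ‖z‖ * kernelK N z]

end Cone

/-- Near two distinct points of the half-space the kernel dominates its reflection by a positive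
constant, independently of `ε`. -/
lemma exists_regKernel_sub_ge (hN : 1 ≤ N) (he : ‖e‖ = 1) {x₀ y₀ : Space N}
    (hx : x₀ ∈ halfSpace e l) (hy : y₀ ∈ halfSpace e l) (hne : y₀ ≠ x₀) :
    ∃ c : ℝ, 0 < c ∧ ∃ ε₀ : ℝ, 0 < ε₀ ∧ ∀ᶠ p in 𝓝 (y₀, x₀), 0 < ‖p.1 - p.2‖ ∧
      ∀ ε, 0 < ε → ε ≤ ε₀ →
        c ≤ regKernel N ε (p.1 - p.2) - regKernel N ε (refl e l p.1 - p.2) := by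
  have hd : 0 < ‖y₀ - x₀‖ := norm_pos_iff.2 (sub_ne_zero.2 hne)
  have hlt : ‖y₀ - x₀‖ < ‖refl e l y₀ - x₀‖ := by
    rw [← sq_lt_sq₀ (norm_nonneg _) (norm_nonneg _), norm_refl_sub_sq he]
    have h1 : 0 < inner ℝ e x₀ - l := sub_pos.2 hx
    have h2 : 0 < inner ℝ e y₀ - l := sub_pos.2 hy
    nlinarith [mul_pos h1 h2]
  set ε₀ := ‖y₀ - x₀‖ / 2 with hε₀
  have hε₀pos : 0 < ε₀ := by positivity
  have hDcont : Continuous fun p : Space N × Space N =>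
      regKernel N ε₀ (p.1 - p.2) - regKernel N ε₀ (refl e l p.1 - p.2) := by
    have h1 := (continuous_regKernel (N := N) hε₀pos).comp
      (show Continuous fun p : Space N × Space N => p.1 - p.2 by fun_prop)
    have h2 := (continuous_regKernel (N := N) hε₀pos).comp
      (((continuous_refl (e := e) (l := l)).comp continuous_fst).sub continuous_snd)
    exact h1.sub h2
  set D := regKernel N ε₀ (y₀ - x₀) - regKernel N ε₀ (refl e l y₀ - x₀) with hD
  have hDpos : 0 < D := by
    rw [hD, regKernel_of_le (by linarith), regKernel_of_le (by linarith), sub_pos]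
    exact div_lt_div_of_pos_left (cConst_pos hN) (by positivity)
      (pow_lt_pow_left₀ hlt (norm_nonneg _) (by omega))
  refine ⟨D / 2, by positivity, ε₀, hε₀pos, ?_⟩
  have ev1 : ∀ᶠ p : Space N × Space N in 𝓝 (y₀, x₀), ε₀ < ‖p.1 - p.2‖ :=
    (show Continuous fun p : Space N × Space N => ‖p.1 - p.2‖ by fun_prop).continuousAt.eventually
      (lt_mem_nhds (by simp only; linarith))
  have ev2 : ∀ᶠ p : Space N × Space N in 𝓝 (y₀, x₀), D / 2 <
      regKernel N ε₀ (p.1 - p.2) - regKernel N ε₀ (refl e l p.1 - p.2) :=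
    hDcont.continuousAt.eventually (lt_mem_nhds (by simp only [← hD]; linarith))
  have ev3 : ∀ᶠ p : Space N × Space N in 𝓝 (y₀, x₀), ε₀ < ‖refl e l p.1 - p.2‖ :=
    (((continuous_refl (e := e) (l := l)).comp continuous_fst).sub
      continuous_snd).norm.continuousAt.eventually
      (lt_mem_nhds (show ε₀ < ‖refl e l y₀ - x₀‖ by linarith))
  filter_upwards [ev1, ev2, ev3] with p h1 h2 h3
  refine ⟨hε₀pos.trans h1, fun ε hε hεε => ?_⟩
  rw [regKernel_of_le h1.le, regKernel_of_le h3.le] at h2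
  rw [regKernel_of_le (hεε.trans h1.le), regKernel_of_le (hεε.trans h3.le)]
  exact h2.le

namespace IsLipschitzSolution

variable {R L : ℝ}

/-- The strong maximum principle: if `u ∘ σ - u` is nonnegative in the half-space and positive at
one of its points, it is positive everywhere in the part of the half-space inside the ball. The
barrier is a flat cone supported in a small ball. -/
lemma strong_maximum_principle (hN : 1 ≤ N) (hu : IsLipschitzSolution R L u g) (he : ‖e‖ = 1)
    (hl : 0 ≤ l) (hle : ∀ x ∈ halfSpace e l, u x ≤ u (refl e l x)) {y₀ : Space N}
    (hy₀ : y₀ ∈ halfSpace e l) (hlt : u y₀ < u (refl e l y₀)) {x₀ : Space N}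
    (hx₀ : x₀ ∈ halfSpace e l) (hx₀R : x₀ ∈ Metric.ball (0 : Space N) R) :
    u x₀ < u (refl e l x₀) := by
  by_cases hne : y₀ = x₀
  · rwa [← hne]
  obtain ⟨C, hC⟩ := hu.bounded_rhs
  obtain ⟨m, hm, H⟩ := exists_deficit_ae_eq_zero hN hu.memH hu.integrable hu.weak
    hu.continuous_rhs.aestronglyMeasurable hC hu.nonneg_const hu.lipschitz_rhs
  obtain ⟨c, hc, ε₀, hε₀, hev⟩ := exists_regKernel_sub_ge hN he hx₀ hy₀ hne
  have hopen : IsOpen (halfSpace e l) := isOpen_lt continuous_const (by fun_prop)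
  have hwc : Continuous fun x => u (refl e l x) - u x :=
    (hu.continuous.comp continuous_refl).sub hu.continuous
  -- a lower bound for `u ∘ σ - u` near `y₀`
  obtain ⟨η, hη⟩ : ∃ η, η = (u (refl e l y₀) - u y₀) / 2 := ⟨_, rfl⟩
  have hηpos : 0 < η := by rw [hη]; linarith
  have hevη : ∀ᶠ x in 𝓝 y₀, η < u (refl e l x) - u x :=
    hwc.continuousAt.eventually (lt_mem_nhds (show η < u (refl e l y₀) - u y₀ by linarith))
  -- the distance between a neighbourhood of `x₀` and its reflection
  obtain ⟨d, hd⟩ : ∃ d, d = inner ℝ e x₀ - l := ⟨_, rfl⟩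
  have hdpos : 0 < d := hd ▸ sub_pos.2 hx₀
  have hdist : ‖refl e l x₀ - x₀‖ = 2 * d := by
    rw [← sq_eq_sq₀ (norm_nonneg _) (by positivity), norm_refl_sub_sq he, ← hd]
    simp; ring
  have hevd : ∀ᶠ p : Space N × Space N in 𝓝 (x₀, x₀), d < ‖refl e l p.1 - p.2‖ :=
    (((continuous_refl (e := e) (l := l)).comp continuous_fst).sub
      continuous_snd).norm.continuousAt.eventually
      (lt_mem_nhds (show d < ‖refl e l x₀ - x₀‖ by linarith))
  -- a neighbourhood of `x₀` of small measure
  have := nontrivial_space hN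
  obtain ⟨U, hUx, hUo, hUm⟩ := Set.exists_isOpen_lt_of_lt (μ := volume) ({x₀} : Set (Space N))
    (ENNReal.ofReal m) (by rw [measure_singleton (μ := volume)]; exact ENNReal.ofReal_pos.2 hm)
  have hevU : ∀ᶠ x in 𝓝 x₀, x ∈ U := hUo.mem_nhds (hUx rfl)
  have hevR : ∀ᶠ x in 𝓝 x₀, x ∈ Metric.ball (0 : Space N) R := Metric.isOpen_ball.mem_nhds hx₀R
  have hevx : ∀ᶠ x in 𝓝 x₀, x ∈ halfSpace e l := hopen.mem_nhds hx₀
  have hevy : ∀ᶠ x in 𝓝 y₀, x ∈ halfSpace e l := hopen.mem_nhds hy₀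
  obtain ⟨r₁, hr₁, h₁⟩ := Metric.eventually_nhds_iff_ball.1
    (hev.and ((hevη.and hevy).prod_inl_nhds x₀))
  obtain ⟨r₂, hr₂, h₂⟩ := Metric.eventually_nhds_iff_ball.1
    (hevd.and ((hevU.and (hevR.and hevx)).prod_inl_nhds x₀))
  set r := min r₁ r₂ with hr
  have hrpos : 0 < r := lt_min hr₁ hr₂
  have k₁ : ∀ x ∈ Metric.ball y₀ r, ∀ y ∈ Metric.ball x₀ r, (x, y) ∈ Metric.ball (y₀, x₀) r₁ :=
    fun x hx y hy => by
      rw [← ball_prod_same]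
      exact ⟨Metric.ball_subset_ball (min_le_left _ _) hx,
        Metric.ball_subset_ball (min_le_left _ _) hy⟩
  have k₂ : ∀ x ∈ Metric.ball x₀ r, ∀ y ∈ Metric.ball x₀ r, (x, y) ∈ Metric.ball (x₀, x₀) r₂ :=
    fun x hx y hy => by
      rw [← ball_prod_same]
      exact ⟨Metric.ball_subset_ball (min_le_right _ _) hx,
        Metric.ball_subset_ball (min_le_right _ _) hy⟩
  have hx₀r : x₀ ∈ Metric.ball x₀ r := Metric.mem_ball_self hrpos
  have hy₀r : y₀ ∈ Metric.ball y₀ r := Metric.mem_ball_self hrpos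
  -- The slope `t` of the barrier: `t * T` bounds the operator applied to the barrier together with
  -- the zero-order terms, and `c * η * V` is the gain from the ball around `y₀`.
  set V := (volume : Measure (Space N)).real (Metric.ball y₀ r) with hV
  set V' := (volume : Measure (Space N)).real (Metric.ball x₀ r) with hV'
  have hVpos : 0 < V :=
    ENNReal.toReal_pos (Metric.measure_ball_pos volume _ hrpos).ne' measure_ball_lt_top.ne
  have hV'0 : 0 ≤ V' := measureReal_nonneg
  set M := ∫ z : Space N, ‖z‖ * kernelK N z with hM
  have hM0 : 0 ≤ M := integral_nonneg fun z => mul_nonneg (norm_nonneg _) (kernelK_nonneg hN _)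
  have hcN := cConst_pos hN
  have hL := hu.nonneg_const
  clear_value V V' M
  set T := M + (|rhoConst N| + L) * r + r * (cConst N / d ^ N) * V' + 1 with hT
  have hTpos : 0 < T := by positivity
  clear_value T
  obtain ⟨t, ht⟩ : ∃ t, t = c * η * V / T := ⟨_, rfl⟩
  have htpos : 0 < t := by rw [ht]; positivity
  set a := cone x₀ r t with ha
  have haB : ∀ x, a x ≠ 0 → x ∈ Metric.ball x₀ r := fun x hx => by
    by_contra h; exact hx (cone_eq_zero h)
  have ha0 : ∀ x, 0 ≤ a x := cone_nonneg htpos.le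
  have hac : Continuous a := continuous_cone
  have hai : Integrable a := hac.integrable_of_hasCompactSupport hasCompactSupport_cone
  have haM : MemH a :=
    memH_of_lipschitz hN (abs_cone_sub_le htpos.le) hac hasCompactSupport_cone
  have haH : ∀ x ∉ halfSpace e l, a x = 0 := fun x hx => by
    by_contra h
    exact hx (h₂ _ (k₂ x (haB x h) x₀ hx₀r)).2.2.2
  have hdef : ∀ x, deficit e l u a x ≠ 0 → x ∈ Metric.ball x₀ r := by
    intro x hx
    obtain ⟨h1, h2⟩ := deficit_of_pos hx
    refine haB x fun h0 => ?_
    have h3 := lt_of_le_of_ne (deficit_nonneg _ x) hx.symm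
    have := hle x h1
    linarith
  have hz := H e l a (Metric.ball x₀ r) he hl haM hai ha0 haH (fun x hx => ?_)
    Metric.isOpen_ball.measurableSet (le_trans (measure_mono fun x hx => ?_) hUm.le)
    (fun x hx => ?_) ?_
  · have h1 := hu.le_of_deficit_ae_eq_zero hac hz hx₀
    have h2 : a x₀ = t * r := by simp [ha, cone, hrpos.le]
    have : 0 < t * r := by positivity
    linarith
  · by_contra h
    exact hx (h₂ _ (k₂ x (hdef x h) x₀ hx₀r)).2.2.1
  · exact (h₂ _ (k₂ x hx x₀ hx₀r)).2.1
  · by_contra h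
    exact hx (hdef x h)
  · filter_upwards [Ioo_mem_nhdsGT (lt_min hε₀ one_pos)] with ε hε y hy
    have hε1 : ε < 1 := hε.2.trans_le (min_le_right _ _)
    have hεε : ε ≤ ε₀ := hε.2.le.trans (min_le_left _ _)
    have hyB := hdef y hy
    have hyH := (deficit_of_pos hy).1
    set z := envelope e l u a with hzdef
    have hσi : Integrable fun x => a (refl e l x) := integrable_comp_refl he hai
    have hzi : Integrable z := by
      have i1 := integrable_comp_refl (l := l) he hu.integrable
      have i2 : Integrable (deficit e l u a) :=
        integrable_deficit hN he hu.memH hu.integrable haM hai haH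
      exact ((i1.sub hu.integrable).add i2).sub (integrable_comp_refl he i2)
    -- the part of the envelope above the barrier
    set z' : Space N → ℝ := fun x => z x - (a x - a (refl e l x)) with hz'
    have hz'i : Integrable z' := hzi.sub (hai.sub hσi)
    have hz'eq : ∀ x ∈ halfSpace e l,
        z' x = max (a x) (u (refl e l x) - u x) - a x := by
      intro x hx
      rw [hz', hzdef]
      simp only
      rw [envelope_eq_max he a hx, haH _ (refl_notMem_halfSpace he hx), sub_zero]
    have hqi : Integrable ((Metric.ball y₀ r).indicator fun _ : Space N => c * η) :=
      (integrable_indicator_iff Metric.isOpen_ball.measurableSet).2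
        (integrableOn_const measure_ball_lt_top.ne)
    -- the gain from the positivity of `u ∘ σ - u` near `y₀`
    have hfar : c * η * V ≤ ∫ x, z' x * regKernel N ε (x - y) := by
      have hint : ∫ x, (Metric.ball y₀ r).indicator (fun _ : Space N => c * η) x = c * η * V := by
        rw [integral_indicator Metric.isOpen_ball.measurableSet, setIntegral_const, ← hV,
          smul_eq_mul, mul_comm]
      rw [← hint]
      refine integral_le_integral_antisymm (l := l) hN hε.1 he hz'i (fun x => ?_) hqi y
        (fun x hx => ?_)
        fun x hx => ?_
      · simp only [hz', hzdef, envelope_refl he, refl_refl he]; ring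
      · rw [hz'eq x hx]
        by_cases hxB : x ∈ Metric.ball y₀ r
        · obtain ⟨⟨hxy, hD⟩, hxη, -⟩ := h₁ _ (k₁ x hxB y hyB)
          rw [Set.indicator_of_mem hxB, mul_comm]
          have hax : a x = 0 := by
            by_contra h
            obtain ⟨⟨h0, -⟩, -⟩ := h₁ _ (k₁ x hxB x (haB x h))
            simp at h0
          rw [hax, sub_zero]
          exact mul_le_mul (hxη.le.trans (le_max_right _ _)) (hD ε hε.1 hεε) hc.le
            (le_max_left _ _)
        · rw [Set.indicator_of_notMem hxB]
          refine mul_nonneg (sub_nonneg.2 (le_max_left _ _)) (sub_nonneg.2 ?_)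
          exact regKernel_anti hN hε.1 (norm_sub_le_norm_refl_sub he hx hyH)
      · refine Set.indicator_of_notMem (fun hxB => hx ?_) _
        exact (h₁ _ (k₁ x hxB x₀ hx₀r)).2.2
    have hrefl : ∫ x, a (refl e l x) * regKernel N ε (x - y)
        ≤ t * (r * (cConst N / d ^ N) * V') := by
      rw [← integral_comp_refl (l := l) he]
      simp only [refl_refl he]
      have hle' : ∀ x, a x * regKernel N ε (refl e l x - y)
          ≤ (Metric.ball x₀ r).indicator (fun _ => t * r * (cConst N / d ^ N)) x := by
        intro x
        by_cases hxB : x ∈ Metric.ball x₀ r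
        · rw [Set.indicator_of_mem hxB]
          have hdx : d < ‖refl e l x - y‖ := (h₂ _ (k₂ x hxB y hyB)).1
          refine mul_le_mul (cone_le htpos.le hrpos.le x) ?_ (regKernel_nonneg hN hε.1 _)
            (by positivity)
          exact div_le_div_of_nonneg_left hcN.le (by positivity)
            (pow_le_pow_left₀ hdpos.le (hdx.le.trans (le_max_left _ _)) _)
        · rw [Set.indicator_of_notMem hxB, ha, cone_eq_zero hxB, zero_mul]
      have hii : Integrable ((Metric.ball x₀ r).indicator
          fun _ : Space N => t * r * (cConst N / d ^ N)) :=
        (integrable_indicator_iff Metric.isOpen_ball.measurableSet).2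
          (integrableOn_const measure_ball_lt_top.ne)
      refine (integral_mono_of_nonneg (Eventually.of_forall fun x =>
        mul_nonneg (ha0 x) (regKernel_nonneg hN hε.1 _)) hii
        (Eventually.of_forall hle')).trans_eq ?_
      rw [integral_indicator Metric.isOpen_ball.measurableSet, setIntegral_const, ← hV',
        smul_eq_mul]
      ring
    have hnear := regMass_mul_cone_sub_le (x₀ := x₀) (r := r) hN hε.1 hε1 htpos.le y
    have hsplit : ∫ x, z x * regKernel N ε (x - y) = (∫ x, z' x * regKernel N ε (x - y))
        + (∫ x, a x * regKernel N ε (x - y)) - ∫ x, a (refl e l x) * regKernel N ε (x - y) := by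
      have j1 := integrable_mul_regKernel hN hε.1 hz'i y
      have j2 := integrable_mul_regKernel hN hε.1 hai y
      have j3 := integrable_mul_regKernel hN hε.1 hσi y
      rw [← integral_add j1 j2, ← integral_sub (by exact j1.add j2) j3]
      refine integral_congr_ae (Eventually.of_forall fun x => ?_)
      simp only [hz']; ring
    have hlow : (rhoConst N + L) * a y ≤ t * ((|rhoConst N| + L) * r) := by
      have h1 : rhoConst N + L ≤ |rhoConst N| + L := by linarith [le_abs_self (rhoConst N)]
      have h2 : 0 ≤ |rhoConst N| + L := add_nonneg (abs_nonneg _) hu.nonneg_const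
      calc (rhoConst N + L) * a y ≤ (|rhoConst N| + L) * a y :=
            mul_le_mul_of_nonneg_right h1 (ha0 y)
        _ ≤ (|rhoConst N| + L) * (t * r) :=
            mul_le_mul_of_nonneg_left (cone_le htpos.le hrpos.le y) h2
        _ = _ := by ring
    have htT : t * T = c * η * V := by rw [ht]; field_simp
    rw [hT] at htT
    rw [hsplit]
    nlinarith

end IsLipschitzSolution

/-! ### Moving planes -/

lemma continuous_refl_left (x : Space N) : Continuous fun l => refl e l x := by
  unfold refl; fun_prop

lemma smul_mem_halfSpace_iff (he : ‖e‖ = 1) {r : ℝ} : r • e ∈ halfSpace e l ↔ l < r := by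
  simp [halfSpace, inner_smul_right, he]

lemma refl_smul (he : ‖e‖ = 1) (r : ℝ) : refl e l (r • e) = (2 * l - r) • e := by
  rw [refl, inner_smul_right, real_inner_self_eq_norm_sq, he, ← sub_smul]
  ring_nf

lemma refl_zero_eq_of_norm_eq {x y : Space N} (hxy : ‖x‖ = ‖y‖) (hne : x ≠ y) :
    x ∈ halfSpace (‖x - y‖⁻¹ • (x - y)) 0 ∧ refl (‖x - y‖⁻¹ • (x - y)) 0 x = y := by
  have hpos : 0 < ‖x - y‖ := norm_pos_iff.2 (sub_ne_zero.2 hne)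
  have h1 : inner ℝ (x - y) x = ‖x - y‖ ^ 2 / 2 := by
    rw [norm_sub_sq_real, inner_sub_left, real_inner_self_eq_norm_sq, real_inner_comm, ← hxy]
    ring
  have h2 : inner ℝ (‖x - y‖⁻¹ • (x - y)) x = ‖x - y‖ / 2 := by
    rw [real_inner_smul_left, h1]
    field_simp
  refine ⟨?_, ?_⟩
  · change (0 : ℝ) < inner ℝ _ x
    rw [h2]; positivity
  · rw [refl, h2, smul_smul, sub_zero, mul_div_cancel₀ _ two_ne_zero, mul_inv_cancel₀ hpos.ne',
      one_smul, sub_sub_cancel]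

namespace IsLipschitzSolution

variable {R L : ℝ}

lemma lt_refl_of_le_refl (hN : 1 ≤ N) (hu : IsLipschitzSolution R L u g)
    (he : ‖e‖ = 1) (hl : 0 < l) (hlR : l < R) (hle : ∀ x ∈ halfSpace e l, u x ≤ u (refl e l x))
    {x : Space N} (hx : x ∈ halfSpace e l) (hxR : x ∈ Metric.ball (0 : Space N) R) :
    u x < u (refl e l x) := by
  have hR : 0 < R := hl.trans hlR
  -- the point `R e` of the sphere is reflected into the ball
  refine hu.strong_maximum_principle hN he hl.le hle (y₀ := R • e)
    ((smul_mem_halfSpace_iff he).2 hlR) ?_ hx hxR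
  rw [hu.eq_zero (R • e) (by simp [norm_smul, he, le_abs_self]), refl_smul he]
  refine hu.pos _ ?_
  rw [mem_ball_zero_iff, norm_smul, he, mul_one, Real.norm_eq_abs, abs_lt]
  constructor <;> linarith

/-- The plane can be moved a little further: the set where the inequality fails shrinks to a
null set, and the maximum principle in sets of small measure applies. -/
lemma eventually_le_refl (hN : 1 ≤ N) (hu : IsLipschitzSolution R L u g)
    (he : ‖e‖ = 1) {s : ℝ} (hs : 0 < s)
    (hle : ∀ x ∈ halfSpace e s, u x ≤ u (refl e s x)) :
    ∀ᶠ l in 𝓝[<] s, ∀ x ∈ halfSpace e l, u x ≤ u (refl e l x) := by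
  obtain ⟨m, hm, H⟩ := hu.exists_small_maximum_principle hN
  set A : ℝ → Set (Space N) := fun l => {x | x ∈ halfSpace e l ∧ u (refl e l x) < u x} with hA
  have hAm : ∀ l, MeasurableSet (A l) := fun l => measurableSet_halfSpace.inter
    (measurableSet_lt (hu.continuous.comp continuous_refl).measurable hu.continuous.measurable)
  have hAB : ∀ l, A l ⊆ Metric.ball 0 R := by
    intro l x hx
    by_contra h
    have h2 : u (refl e l x) < u x := hx.2
    rw [hu.eq_zero x h] at h2
    linarith [hu.nonneg (refl e l x)]
  have hlim : Tendsto (fun l => volume (A l)) (𝓝[<] s) (𝓝 (volume (∅ : Set (Space N)))) := by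
    refine tendsto_measure_of_ae_tendsto_indicator _ MeasurableSet.empty hAm
      Metric.isOpen_ball.measurableSet measure_ball_lt_top.ne (Eventually.of_forall hAB) ?_
    have hplane : ∀ᵐ x : Space N, inner ℝ e x ≠ s := by
      rw [ae_iff]; simpa using volume_hyperplane (l := s) he
    filter_upwards [hplane] with x hx
    rcases hx.lt_or_gt with h | h
    · filter_upwards [nhdsWithin_le_nhds (lt_mem_nhds h)] with l hl
      simp only [Set.mem_empty_iff_false, iff_false]
      exact fun hxA => lt_asymm hl hxA.1
    · by_cases hxR : x ∈ Metric.ball (0 : Space N) R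
      · have hsR' : s < R := by
          have := real_inner_le_norm e x
          rw [he, one_mul] at this
          rw [mem_ball_zero_iff] at hxR
          linarith
        have hlt := hu.lt_refl_of_le_refl hN he hs hsR' hle h hxR
        have hc : Continuous fun l => u (refl e l x) := hu.continuous.comp (continuous_refl_left x)
        filter_upwards [nhdsWithin_le_nhds (hc.continuousAt.eventually (lt_mem_nhds hlt))]
          with l hl
        simp only [Set.mem_empty_iff_false, iff_false]
        exact fun hxA => lt_asymm hl hxA.2
      · exact Eventually.of_forall fun l => by
          simp only [Set.mem_empty_iff_false, iff_false]
          exact fun hxA => hxR (hAB l hxA)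
  rw [measure_empty] at hlim
  filter_upwards [hlim.eventually (gt_mem_nhds (ENNReal.ofReal_pos.2 hm)),
    nhdsWithin_le_nhds (lt_mem_nhds hs)] with l h1 h2
  exact H e l he (le_of_lt h2) h1.le

lemma le_refl_of_tendsto (hu : IsLipschitzSolution R L u g) {s : ℝ}
    (h : ∀ᶠ l in 𝓝[>] s, ∀ x ∈ halfSpace e l, u x ≤ u (refl e l x)) :
    ∀ x ∈ halfSpace e s, u x ≤ u (refl e s x) := by
  intro x hx
  have hc : Continuous fun l => u (refl e l x) := hu.continuous.comp (continuous_refl_left x)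
  refine ge_of_tendsto (hc.continuousAt.tendsto.mono_left
    (nhdsWithin_le_nhds (s := Set.Ioi s))) ?_
  filter_upwards [h, nhdsWithin_le_nhds (gt_mem_nhds (show s < inner ℝ e x from hx))] with l h1 h2
  exact h1 x h2

lemma le_refl_of_pos (hN : 1 ≤ N) (hu : IsLipschitzSolution R L u g)
    (he : ‖e‖ = 1) (hl : 0 < l) (hlR : l ≤ R) :
    ∀ x ∈ halfSpace e l, u x ≤ u (refl e l x) := by
  set P : ℝ → Prop := fun l => ∀ x ∈ halfSpace e l, u x ≤ u (refl e l x) with hP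
  by_contra hbad
  set T : Set ℝ := {t | l ≤ t ∧ t ≤ R ∧ ¬ P t} with hT
  have hlT : l ∈ T := ⟨le_rfl, hlR, hbad⟩
  have hbdd : BddAbove T := ⟨R, fun t ht => ht.2.1⟩
  set s := sSup T with hs
  have hls : l ≤ s := le_csSup hbdd hlT
  have hsR : s ≤ R := csSup_le ⟨l, hlT⟩ fun t ht => ht.2.1
  have hPs : P s := by
    rcases hsR.eq_or_lt with h | h
    · intro x hx
      have hx' : R < inner ℝ e x := h ▸ hx
      have := real_inner_le_norm e x
      rw [he, one_mul] at this
      rw [hu.eq_zero x (by rw [mem_ball_zero_iff]; linarith)]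
      exact hu.nonneg _
    · refine hu.le_refl_of_tendsto ?_
      filter_upwards [Ioo_mem_nhdsGT h] with t ht
      by_contra hbad
      have : t ≤ s := le_csSup hbdd ⟨hls.trans ht.1.le, ht.2.le, hbad⟩
      exact absurd ht.1 (not_lt.2 this)
  have hev := hu.eventually_le_refl hN he (hl.trans_le hls) hPs
  obtain ⟨b, hb, hbs⟩ := (mem_nhdsLT_iff_exists_Ioo_subset).1 hev
  obtain ⟨t, htT, hbt⟩ := exists_lt_of_lt_csSup ⟨l, hlT⟩ hb
  have hts : t ≤ s := le_csSup hbdd htT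
  rcases hts.eq_or_lt with h | h
  · exact htT.2.2 (h ▸ hPs)
  · exact htT.2.2 (hbs ⟨hbt, h⟩)

lemma eq_of_norm_eq (hN : 1 ≤ N) (hR : 0 < R) (hu : IsLipschitzSolution R L u g)
    {x y : Space N} (hxy : ‖x‖ = ‖y‖) : u x = u y := by
  have key : ∀ x y : Space N, ‖x‖ = ‖y‖ → u x ≤ u y := by
    intro x y hxy
    by_cases hne : x = y
    · rw [hne]
    obtain ⟨hx, hr⟩ := refl_zero_eq_of_norm_eq hxy hne
    have he : ‖‖x - y‖⁻¹ • (x - y)‖ = 1 := norm_smul_inv_norm (𝕜 := ℝ) (sub_ne_zero.2 hne)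
    have := hu.le_refl_of_tendsto (e := ‖x - y‖⁻¹ • (x - y)) (s := 0)
      (by
        filter_upwards [Ioo_mem_nhdsGT hR] with l hl
        exact hu.le_refl_of_pos hN he hl.1 hl.2.le) x hx
    rwa [hr] at this
  exact le_antisymm (key x y hxy) (key y x hxy.symm)

lemma strictAntiOn_smul (hN : 1 ≤ N) (hu : IsLipschitzSolution R L u g) (he : ‖e‖ = 1) :
    StrictAntiOn (fun r : ℝ => u (r • e)) (Set.Icc 0 R) := by
  intro a ha b hb hab
  simp only
  rcases hb.2.eq_or_lt with h | h
  · rw [hu.eq_zero (b • e) (by simp [norm_smul, he, h, le_abs_self])]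
    refine hu.pos _ ?_
    rw [mem_ball_zero_iff, norm_smul, he, mul_one, Real.norm_of_nonneg ha.1]
    linarith
  · have hl : 0 < (a + b) / 2 := by linarith [ha.1]
    have hlR : (a + b) / 2 < R := by linarith
    have := hu.lt_refl_of_le_refl hN he hl hlR (hu.le_refl_of_pos hN he hl hlR.le)
      (x := b • e) ((smul_mem_halfSpace_iff he).2 (by linarith)) (by
        rwa [mem_ball_zero_iff, norm_smul, he, mul_one, Real.norm_of_nonneg hb.1])
    have hab2 : 2 * ((a + b) / 2) - b = a := by ring
    rwa [refl_smul he, hab2] at this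

end IsLipschitzSolution

lemma exists_isLipschitzSolution {R : ℝ} {f : ℝ → ℝ} (hf : LocallyLipschitz f)
    (hcont : ContinuousOn u (Metric.closedBall 0 R)) (hmem : MemHOn (Metric.ball 0 R) u)
    (hpos : ∀ x ∈ Metric.ball (0 : Space N) R, 0 < u x)
    (hsol : IsWeakSolution (Metric.ball 0 R) (fun x => f (u x)) u)
    (hzero : ∀ x ∉ Metric.ball (0 : Space N) R, u x = 0) :
    ∃ L, IsLipschitzSolution R L u fun x => f (u x) := by
  have hc : Continuous u := by
    have h1 : ContinuousOn u (Metric.ball (0 : Space N) R)ᶜ :=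
      continuousOn_const.congr hzero
    rw [← continuousOn_univ]
    refine (hcont.union_of_isClosed h1 Metric.isClosed_closedBall
      Metric.isOpen_ball.isClosed_compl).mono fun x _ => ?_
    by_cases hx : x ∈ Metric.ball (0 : Space N) R
    · exact Or.inl (Metric.ball_subset_closedBall hx)
    · exact Or.inr hx
  have hsupp : HasCompactSupport u :=
    HasCompactSupport.intro (isCompact_closedBall (0 : Space N) R) fun x hx =>
      hzero x fun h => hx (Metric.ball_subset_closedBall h)
  have hrange := hsupp.isCompact_range hc
  obtain ⟨K, hK⟩ := LocallyLipschitzOn.exists_lipschitzOnWith_of_compact hrange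
    (hf.locallyLipschitzOn (s := Set.range u))
  obtain ⟨C, hC⟩ := hrange.exists_bound_of_continuousOn hf.continuous.continuousOn
  refine ⟨K, hc, hmem.1, hpos, hzero, fun φ hφ hφ0 => ?_, hf.continuous.comp hc,
    ⟨C, fun x => hC _ ⟨x, rfl⟩⟩, K.2, fun x y => ?_⟩
  · have h1 := hsol.1.2.2 φ hφ (Eventually.of_forall hφ0)
    have h2 := hsol.2.2.2 φ hφ (Eventually.of_forall hφ0)
    rw [le_antisymm h2 h1]
    refine setIntegral_eq_integral_of_ae_compl_eq_zero ?_
    filter_upwards [hφ.2] with x hx hxB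
    rw [hx hxB, mul_zero]
  · exact hK.dist_le_mul _ ⟨x, rfl⟩ _ ⟨y, rfl⟩

end LogLap

theorem mainTheorem3 (N : ℕ) (hN : 1 ≤ N) (R : ℝ) (hR : 0 < R)
    (f : ℝ → ℝ) (hf : LocallyLipschitz f)
    (u : EuclideanSpace ℝ (Fin N) → ℝ)
    (hcont : ContinuousOn u (Metric.closedBall 0 R))
    (hmem : LogLap.MemHOn (Metric.ball 0 R) u)
    (hpos : ∀ x ∈ Metric.ball (0 : EuclideanSpace ℝ (Fin N)) R, 0 < u x)
    (hsol : LogLap.IsWeakSolution (Metric.ball 0 R) (fun x => f (u x)) u)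
    (hzero : ∀ x ∉ Metric.ball (0 : EuclideanSpace ℝ (Fin N)) R, u x = 0) :
    ∃ g : ℝ → ℝ, (∀ x, u x = g ‖x‖) ∧ StrictAntiOn g (Set.Icc 0 R) := by
  obtain ⟨L, hu⟩ := LogLap.exists_isLipschitzSolution hf hcont hmem hpos hsol hzero
  have := LogLap.nontrivial_space hN
  obtain ⟨e, he⟩ := exists_norm_eq (LogLap.Space N) zero_le_one
  refine ⟨fun r => u (r • e), fun x => ?_, hu.strictAntiOn_smul hN he⟩
  exact hu.eq_of_norm_eq hN hR (by simp [norm_smul, he])
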